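/- All graphs are finite, undirected, without loops or parallel edges. For a graph $G$ with node set $VG$ and edge set $EG$, a 2-matching in $G$ is a function $x\colon EG\to\{0,1,2\}$ such that for each $v\in VG$ the sum of $x(e)$ over the edges $e$ incident to $v$ is at most $2$; its size is $\sum_{e} x(e)$. It is triangle-free if $\{e : x(e)\neq 0\}$ contains no triangle, and basic if $\{e : x(e)=1\}$ partitions into a collection of node-disjoint circuits of odd length. Let $\nu_2^3(G)$ be the maximum size of a triangle-free 2-matching in $G$. A triangle cluster is a connected graph whose edges partition into triangles such that any two of these triangles have at most one node in common and, if such a node exists, it is an articulation point that separates the two triangles (after removing it, no remaining node of one triangle is connected to a remaining node of the other); a single node is a triangle cluster. For $U\subseteq VG$ let $G-U$ be the graph obtained from $G$ by removing the nodes of $U$, and let $\mathrm{cluster}(H)$ be the number of connected components of $H$ that are triangle clusters. Theorem (Cornuéjols–Pulleyblank). For every graph $G$, $$\nu_2^3(G)=\min_{U\subseteq VG}\bigl(|VG|+|U|-\mathrm{cluster}(G-U)\bigr),$$ where both the maximum defining $\nu_2^3(G)$ and the minimum are attained; moreover the maximum is attained by a basic triangle-free 2-matching, so the formula is the same whether or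 not 2-matchings are required to be basic. -/

import Mathlib

/-- A 2-matching in `G`: a function `x` from the edges of `G` to `{0, 1, 2}` such that for each
node `v` the sum of the values `x e` over all edges `e` incident to `v` does not exceed `2`. -/
def IsTwoMatching {V : Type*} [Fintype V] (G : SimpleGraph V) (x : G.edgeSet → ℕ) : Prop :=
  (∀ e, x e ≤ 2) ∧ ∀ v : V, (∑ᶠ (e : G.edgeSet) (_ : v ∈ e.1), x e) ≤ 2

/-- The size of `x`: the sum of `x e` over all edges. -/
noncomputable def twoMatchingSize {V : Type*} [Fintype V] (G : SimpleGraph V)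
    (x : G.edgeSet → ℕ) : ℕ :=
  ∑ᶠ e : G.edgeSet, x e

/-- The graph on `V` whose edges are the support of `x`, that is, the edges with `x e ≠ 0`. -/
def supportGraph {V : Type*} (G : SimpleGraph V) (x : G.edgeSet → ℕ) : SimpleGraph V :=
  SimpleGraph.fromEdgeSet {e : Sym2 V | ∃ h : e ∈ G.edgeSet, x ⟨e, h⟩ ≠ 0}

/-- A triangle-free 2-matching: a 2-matching whose support contains no triangle. -/
def IsTriangleFreeTwoMatching {V : Type*} [Fintype V] (G : SimpleGraph V)
    (x : G.edgeSet → ℕ) : Prop :=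
  IsTwoMatching G x ∧ (supportGraph G x).CliqueFree 3

/-- `x` is basic if the edges with `x e = 1` partition into a collection `𝒞` of node-disjoint
circuits of odd length. -/
def IsBasic {V : Type*} (G : SimpleGraph V) (x : G.edgeSet → ℕ) : Prop :=
  ∃ 𝒞 : Set G.Subgraph,
    (∀ C ∈ 𝒞, ∃ (u : V) (p : G.Walk u u), p.IsCycle ∧ Odd p.length ∧ C = p.toSubgraph) ∧
    (∀ C ∈ 𝒞, ∀ C' ∈ 𝒞, C ≠ C' → Disjoint C.verts C'.verts) ∧
    {e : Sym2 V | ∃ h : e ∈ G.edgeSet, x ⟨e, h⟩ = 1} = ⋃ C ∈ 𝒞, C.edgeSet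

/-- The maximum size of a triangle-free 2-matching in `G`. (Sizes are bounded by the number of
nodes, since twice the size is the sum of the values at all nodes, so this is a true maximum; the
main theorem says so explicitly.) -/
noncomputable def triangleFreeTwoMatchingNumber {V : Type*} [Fintype V]
    (G : SimpleGraph V) : ℕ :=
  sSup {k : ℕ | ∃ x, IsTriangleFreeTwoMatching G x ∧ twoMatchingSize G x = k}

/-- The node `v` separates the node sets `S` and `T` in `H`: after the removal of `v`, no node of
`S` other than `v` is connected to a node of `T` other than `v`. -/
def Separates {W : Type*} (H : SimpleGraph W) (v : W) (S T : Set W) : Prop :=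
  ∀ (a b : W) (ha : a ≠ v) (hb : b ≠ v), a ∈ S → b ∈ T →
    ¬ (H.induce {w : W | w ≠ v}).Reachable ⟨a, ha⟩ ⟨b, hb⟩

/-- A triangle cluster: a connected graph whose edges partition into triangles (a set `𝒯` of
triangles such that each edge lies in exactly one member of `𝒯`) such that any two of the
triangles have at most one node in common, and if such a node exists, it is an articulation point
that separates the two triangles from each other. A single node is a triangle cluster (with no
triangles). -/
def IsTriangleCluster {W : Type*} (H : SimpleGraph W) : Prop :=
  H.Connected ∧
  ∃ 𝒯 : Set (Finset W),
    (∀ T ∈ 𝒯, H.IsNClique 3 T) ∧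
    (∀ a b : W, H.Adj a b → ∃! T : Finset W, T ∈ 𝒯 ∧ a ∈ T ∧ b ∈ T) ∧
    (∀ T ∈ 𝒯, ∀ T' ∈ 𝒯, T ≠ T' →
      ((T : Set W) ∩ T').Subsingleton ∧
      ∀ v ∈ (T : Set W) ∩ T', Separates H v T T')

/-- The number of the connected components of `H` that are triangle clusters. -/
noncomputable def clusterCount {W : Type*} (H : SimpleGraph W) : ℕ :=
  {c : H.ConnectedComponent | IsTriangleCluster c.toSimpleGraph}.ncard

/-- The graph `G - U` obtained from `G` by removing the nodes in `U`. -/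
def removeNodes {V : Type*} (G : SimpleGraph V) (U : Finset V) :
    SimpleGraph {v : V | v ∉ U} :=
  G.induce {v : V | v ∉ U}

/-!
The upper bound is a count. A triangle of `G` contributes at most two to the size of a triangle-free
2-matching, and a triangle cluster with `n` nodes has at most `(n - 1) / 2` triangles
(`two_mul_card_triangles_lt`), so the edges inside a triangle cluster contribute at most `n - 1`. The
edges inside any other component of `G - U` contribute at most the number of its nodes, and the edges
at `U` at most `2 * #U` (`twoMatchingSize_add_clusterCount_le`).

For the lower bound call a node set packable if it is the union of disjoint edges and odd circuits of
length at least five; a packable set `S` carries a basic triangle-free 2-matching of size `#S`. Two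
facts are combined.

* A Gallai–Edmonds decomposition (`exists_isGallaiEdmonds`): there are a set `U` and a partition `𝒦`
  of the other nodes into factor-critical sets without edges between them, together with a matching
  that misses at most `#𝒦 - #U` nodes. It comes from Gallai's lemma: if every node is missed by some
  maximum matching, then "no maximum matching misses both nodes" is an equivalence relation.
* A factor-critical set is packable or a triangle cluster (`FactorCritical.triangleTree`). Matchings
  that miss only `p` and only `u`, for adjacent `p` and `u`, form with the edge `pu` an odd circuit and
  disjoint edges and even circuits (`packable_of_adj`). If the set is not packable, this odd circuit
  is always a triangle, and these triangles fit together in the shape of a tree.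

Hall's theorem assigns the nodes of `U` to distinct neighbouring members of `𝒦` such that at most `d`
of the non-packable members receive no node, where `d` is the largest value of `#𝒮 - #N(𝒮)` over the
sets `𝒮` of non-packable members and `N(𝒮)` is the set of their neighbours in `U`. Hence some
packable set contains all but `d` nodes of `G`. The members of an optimal `𝒮` are triangle clusters and components of
`G - N(𝒮)`, so `N(𝒮)` attains the minimum (`exists_packable_add_clusterCount`).
-/

namespace TwoMatching
open Classical

section

variable {V : Type*} {G : SimpleGraph V}

/-! ### Perfect matchings of node sets -/

/-- `m` is a perfect matching of the node set `S`, encoded as an involution of all nodes: `m` sends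
each node of `S` to its partner and fixes the nodes outside `S`. -/
structure IsMatchingOn (G : SimpleGraph V) (S : Finset V) (m : V → V) : Prop where
  invol : ∀ v, m (m v) = v
  adj : ∀ v ∈ S, G.Adj v (m v)
  fix : ∀ v ∉ S, m v = v

/-- The subgraph induced by `S` has a perfect matching. -/
def Matchable (G : SimpleGraph V) (S : Finset V) : Prop := ∃ m, IsMatchingOn G S m

/-- The subgraph induced by `K` has a perfect matching after the removal of any one node. -/
def FactorCritical (G : SimpleGraph V) (K : Finset V) : Prop :=
  K.Nonempty ∧ ∀ v ∈ K, Matchable G (K.erase v)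

namespace IsMatchingOn

variable {S T : Finset V} {m n : V → V}

lemma mem (h : IsMatchingOn G S m) {v : V} (hv : v ∈ S) : m v ∈ S := by
  by_contra hm
  have h1 := h.fix _ hm
  have h2 := h.adj v hv
  rw [h.invol] at h1
  exact h2.ne h1

lemma union (h : IsMatchingOn G S m) (h' : IsMatchingOn G T n) (hd : Disjoint S T) :
    IsMatchingOn G (S ∪ T) (m ∘ n) := by
  rw [Finset.disjoint_left] at hd
  have e1 : ∀ v ∈ T, m (n v) = n v := fun v hv => h.fix _ fun hs => hd hs (h'.mem hv)
  have e2 : ∀ v ∈ S, m (n v) = m v := fun v hv => by rw [h'.fix _ (hd hv)]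
  refine ⟨fun v => ?_, fun v hv => ?_, fun v hv => ?_⟩
  · simp only [Function.comp]
    by_cases hT : v ∈ T
    · rw [e1 v hT, h'.invol, h.fix v fun hs => hd hs hT]
    · rw [h'.fix v hT]
      by_cases hS : v ∈ S
      · rw [e2 _ (h.mem hS), h.invol]
      · rw [h.fix v hS, h'.fix v hT, h.fix v hS]
  · rcases Finset.mem_union.1 hv with hS | hT
    · simpa [e2 v hS] using h.adj v hS
    · simpa [e1 v hT] using h'.adj v hT
  · rw [Finset.mem_union, not_or] at hv
    simp [h'.fix v hv.2, h.fix v hv.1]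

lemma restrict (h : IsMatchingOn G S m) (hT : T ⊆ S) (hm : ∀ v ∈ T, m v ∈ T) :
    IsMatchingOn G T (fun v => if v ∈ T then m v else v) := by
  refine ⟨fun v => ?_, fun v hv => ?_, fun v hv => ?_⟩
  · by_cases hv : v ∈ T
    · simp [hv, hm v hv, h.invol]
    · simp [hv]
  · simpa [hv] using h.adj v (hT hv)
  · simp [hv]

lemma restrict_sdiff (h : IsMatchingOn G S m) (hm : ∀ v ∈ T, m v ∈ T) :
    IsMatchingOn G (S \ T) (fun v => if v ∈ S \ T then m v else v) := by
  refine h.restrict Finset.sdiff_subset fun v hv => ?_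
  rw [Finset.mem_sdiff] at hv ⊢
  refine ⟨h.mem hv.1, fun hT => hv.2 ?_⟩
  simpa [h.invol] using hm _ hT

end IsMatchingOn

namespace Matchable

lemma even_card {S : Finset V} (h : Matchable G S) : Even S.card := by
  obtain ⟨m, hm⟩ := h
  have hS : ∀ v : S, m v ∈ S := fun v => hm.mem v.2
  let f : S → S := fun v => ⟨m v, hS v⟩
  have hf : Function.Involutive f := fun v => Subtype.ext (hm.invol v)
  have h1 : (hf.toPerm f) ^ 2 = 1 := by
    ext v
    simp [pow_two, hf v]
  have h2 := Equiv.Perm.two_dvd_card_support h1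
  have h3 : (hf.toPerm f).support = Finset.univ := by
    ext v
    simpa [f, Subtype.ext_iff] using (hm.adj v v.2).ne'
  rw [h3, Finset.card_univ, Fintype.card_coe] at h2
  exact even_iff_two_dvd.2 h2

lemma union {S T : Finset V} (h : Matchable G S) (h' : Matchable G T) (hd : Disjoint S T) :
    Matchable G (S ∪ T) :=
  ⟨_, h.choose_spec.union h'.choose_spec hd⟩

lemma empty : Matchable G ∅ := ⟨id, by simp, by simp, by simp⟩

end Matchable

lemma isMatchingOn_swap {a b : V} (h : G.Adj a b) :
    IsMatchingOn G {a, b} (Equiv.swap a b) := by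
  refine ⟨fun v => by simp, fun v hv => ?_, fun v hv => ?_⟩
  · rw [Finset.mem_insert, Finset.mem_singleton] at hv
    rcases hv with rfl | rfl
    · simpa using h
    · simpa using h.symm
  · simp only [Finset.mem_insert, Finset.mem_singleton, not_or] at hv
    exact Equiv.swap_apply_of_ne_of_ne hv.1 hv.2

lemma Matchable.pair {a b : V} (h : G.Adj a b) : Matchable G {a, b} := ⟨_, isMatchingOn_swap h⟩

lemma FactorCritical.odd_card {K : Finset V} (h : FactorCritical G K) : Odd K.card := by
  obtain ⟨v, hv⟩ := h.1
  have := (h.2 v hv).even_card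
  rw [← Finset.card_erase_add_one hv]
  exact this.add_one

/-! ### Maximum matchings -/

/-- `m` is a maximum matching of the subgraph induced by `S`, and `T` is the set of the nodes that
it covers. -/
structure IsMaxMatching (G : SimpleGraph V) (S T : Finset V) (m : V → V) : Prop where
  isMatchingOn : IsMatchingOn G T m
  subset : T ⊆ S
  max : ∀ T' ⊆ S, Matchable G T' → T'.card ≤ T.card

lemma exists_isMaxMatching (G : SimpleGraph V) (S : Finset V) : ∃ T m, IsMaxMatching G S T m := by
  obtain ⟨T, hT, hmax⟩ := Finset.exists_max_image (S.powerset.filter (Matchable G)) Finset.card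
    ⟨∅, by simp [Matchable.empty]⟩
  rw [Finset.mem_filter, Finset.mem_powerset] at hT
  obtain ⟨hTS, m, hm⟩ := hT
  exact ⟨T, m, hm, hTS, fun T' h h' => hmax T' (by simp [h, h'])⟩

/-- No maximum matching of the subgraph induced by `S` misses both `x` and `y`, unless `x = y`. -/
def NotBothMissed (G : SimpleGraph V) (S : Finset V) (x y : V) : Prop :=
  x = y ∨ ∀ T m, IsMaxMatching G S T m → x ∈ T ∨ y ∈ T

lemma notBothMissed_of_adj {S : Finset V} {x y : V} (hx : x ∈ S) (hy : y ∈ S) (h : G.Adj x y) :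
    NotBothMissed G S x y := by
  right
  intro T m hT
  by_contra! hc
  have h1 : Disjoint T {x, y} := by simp [hc.1, hc.2]
  have h2 := hT.max (T ∪ {x, y}) (Finset.union_subset hT.subset (by simp [Finset.insert_subset_iff, hx, hy]))
    (Matchable.union ⟨m, hT.isMatchingOn⟩ (.pair h) h1)
  rw [Finset.card_union_of_disjoint h1, Finset.card_pair h.ne] at h2
  omega

/-- The exchange step in Gallai's lemma. If a maximum matching `m` missed both `x` and `y`, then
among the maximum matchings that miss `w` the one that agrees most with `m` could be improved. -/
lemma NotBothMissed.trans [Fintype V] {S : Finset V} {x w y : V}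
    (hw : ∃ T m, IsMaxMatching G S T m ∧ w ∉ T)
    (hxw : NotBothMissed G S x w) (hwy : NotBothMissed G S w y) : NotBothMissed G S x y := by
  by_cases hxy : x = y
  · exact Or.inl hxy
  rcases hxw with rfl | hxw
  · exact hwy
  rcases hwy with rfl | hwy
  · exact Or.inr hxw
  right
  intro T m hT
  by_contra! hc
  obtain ⟨n, hn, hmax⟩ := Finset.exists_max_image
    (Finset.univ.filter fun n : V → V => ∃ T', IsMaxMatching G S T' n ∧ w ∉ T')
    (fun n => (Finset.univ.filter fun v => m v = n v).card)
    (by obtain ⟨T', n, h⟩ := hw; exact ⟨n, by simpa using ⟨T', h⟩⟩)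
  simp only [Finset.mem_filter, Finset.mem_univ, true_and] at hn hmax
  obtain ⟨T', hT', hwT'⟩ := hn
  have hxT' : x ∈ T' := (hxw T' n hT').resolve_right hwT'
  have hyT' : y ∈ T' := (hwy T' n hT').resolve_left hwT'
  have hcard : T.card = T'.card :=
    le_antisymm (hT'.max T hT.subset ⟨m, hT.isMatchingOn⟩) (hT.max T' hT'.subset ⟨n, hT'.isMatchingOn⟩)
  have h2 : 1 < (T \ T').card := by
    rw [Finset.card_sdiff_comm hcard, Finset.one_lt_card]
    exact ⟨x, by simp [hxT', hc.1], y, by simp [hyT', hc.2], hxy⟩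
  obtain ⟨z, hz, hzw⟩ := Finset.exists_mem_ne h2 w
  rw [Finset.mem_sdiff] at hz
  obtain ⟨hzT, hzT'⟩ := hz
  obtain ⟨y', hy'⟩ : ∃ y', y' = m z := ⟨_, rfl⟩
  have hadj : G.Adj z y' := hy' ▸ hT.isMatchingOn.adj z hzT
  have hmy' : m y' = z := by rw [hy', hT.isMatchingOn.invol]
  have hy'T : y' ∈ T := hy' ▸ hT.isMatchingOn.mem hzT
  have hy'T' : y' ∈ T' :=
    ((notBothMissed_of_adj (hT.subset hzT) (hT.subset hy'T) hadj).resolve_left hadj.ne T' n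
      hT').resolve_left hzT'
  obtain ⟨t, ht⟩ : ∃ t, t = n y' := ⟨_, rfl⟩
  have hnt : n t = y' := by rw [ht, hT'.isMatchingOn.invol]
  have htT' : t ∈ T' := ht ▸ hT'.isMatchingOn.mem hy'T'
  have hty' : t ≠ y' := by rw [ht]; exact (hT'.isMatchingOn.adj _ hy'T').ne'
  have htz : t ≠ z := fun h => hzT' (h ▸ htT')
  have hnz : n z = z := hT'.isMatchingOn.fix z hzT'
  -- the matching `n` with the edge `y't` replaced by the edge `zy'` of `m`
  let n' : V → V := fun v => if v = z then y' else if v = y' then z else if v = t then t else n v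
  have hn' : IsMatchingOn G (insert z (T'.erase t)) n' := by
    refine ⟨fun v => ?_, fun v hv => ?_, fun v hv => ?_⟩
    · have h1 := hT'.isMatchingOn.invol v
      have := hadj.ne
      simp only [n']
      grind
    · have h1 := hT'.isMatchingOn.adj v
      have := hadj.symm
      simp only [n']
      grind
    · have h1 := hT'.isMatchingOn.fix v
      simp only [n']
      grind
  have hcard' : (insert z (T'.erase t)).card = T'.card := by
    rw [Finset.card_insert_of_notMem (by simp [hzT']), Finset.card_erase_add_one htT']
  have hlt : (Finset.univ.filter fun v => m v = n v).card <
      (Finset.univ.filter fun v => m v = n' v).card := by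
    refine Finset.card_lt_card ⟨fun v hv => ?_, fun h => ?_⟩
    · simp only [Finset.mem_filter, Finset.mem_univ, true_and, n'] at hv ⊢
      have := hT.isMatchingOn.invol v
      grind
    · have h1 : z ∈ Finset.univ.filter fun v => m v = n v := h (by simp [n', hy'])
      rw [Finset.mem_filter] at h1
      exact hadj.ne (by rw [hy', h1.2, hnz])
  refine absurd (hmax n' ⟨_, ⟨hn', ?_, fun A h h' => hcard' ▸ hT'.max A h h'⟩, ?_⟩) hlt.not_ge
  · exact Finset.insert_subset (hT.subset hzT) ((Finset.erase_subset _ _).trans hT'.subset)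
  · simp [hzw.symm, hwT']

/-! ### Gallai–Edmonds decomposition -/

/-- A set `U` of nodes and a partition `𝒦` of the other nodes of `S` into factor-critical sets such
that edges leave the members of `𝒦` only towards `U`, and some matching misses at most
`#𝒦 - #U` nodes of `S`. -/
structure IsGallaiEdmonds (G : SimpleGraph V) (S U : Finset V) (𝒦 : Finset (Finset V)) : Prop where
  subset : U ⊆ S
  cover : ∀ v ∈ S, v ∈ U ∨ ∃ K ∈ 𝒦, v ∈ K
  critical : ∀ K ∈ 𝒦, FactorCritical G K
  part : ∀ K ∈ 𝒦, K ⊆ S \ U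
  eq_of_mem : ∀ K ∈ 𝒦, ∀ K' ∈ 𝒦, ∀ v ∈ K, v ∈ K' → K = K'
  closed : ∀ K ∈ 𝒦, ∀ a ∈ K, ∀ b ∈ S, G.Adj a b → b ∈ K ∨ b ∈ U
  matching : ∃ T ⊆ S, Matchable G T ∧ S.card + U.card ≤ T.card + 𝒦.card

lemma isGallaiEdmonds_of_forall_missed [Fintype V] {S : Finset V}
    (hS : ∀ v ∈ S, ∃ T m, IsMaxMatching G S T m ∧ v ∉ T) :
    ∃ 𝒦, IsGallaiEdmonds G S ∅ 𝒦 := by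
  let H : SimpleGraph V :=
    { Adj := fun a b => G.Adj a b ∧ a ∈ S ∧ b ∈ S
      symm := ⟨fun a b h => ⟨h.1.symm, h.2.2, h.2.1⟩⟩
      loopless := ⟨fun a h => h.1.ne rfl⟩ }
  have hR : ∀ x y, x ∈ S → H.Reachable x y → NotBothMissed G S x y := by
    rintro x y hx ⟨p⟩
    induction p with
    | nil => exact Or.inl rfl
    | cons h p ih => exact (notBothMissed_of_adj hx h.2.2 h.1).trans (hS _ h.2.2) (ih h.2.2)
  let comp : V → Finset V := fun v => S.filter (H.Reachable v)
  have hcomp : ∀ x y, H.Reachable x y → comp x = comp y := by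
    intro x y h
    ext z
    simp only [comp, Finset.mem_filter, and_congr_right_iff]
    exact fun _ => ⟨h.symm.trans, h.trans⟩
  have hmem : ∀ v ∈ S, v ∈ comp v := fun v hv => by simp [comp, hv]
  have hcl : ∀ v a b, a ∈ comp v → b ∈ S → G.Adj a b → b ∈ comp v := by
    intro v a b ha hb hab
    rw [Finset.mem_filter] at ha ⊢
    exact ⟨hb, ha.2.trans (SimpleGraph.Adj.reachable ⟨hab, ha.1, hb⟩)⟩
  refine ⟨S.image comp, by simp, fun v hv => Or.inr ⟨comp v, Finset.mem_image_of_mem _ hv, hmem v hv⟩,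
    ?_, ?_, ?_, ?_, ?_⟩
  · intro K hK
    obtain ⟨v₀, hv₀, rfl⟩ := Finset.mem_image.1 hK
    refine ⟨⟨v₀, hmem _ hv₀⟩, fun v hv => ?_⟩
    rw [Finset.mem_filter] at hv
    rw [hcomp _ _ hv.2]
    obtain ⟨T, m, hT, hvT⟩ := hS v hv.1
    have hsub : (comp v).erase v ⊆ T := by
      intro w hw
      rw [Finset.mem_erase, Finset.mem_filter] at hw
      exact (((hR v w hv.1 hw.2.2).resolve_left hw.1.symm) T m hT).resolve_left hvT
    refine ⟨_, hT.isMatchingOn.restrict hsub fun w hw => ?_⟩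
    have hwT := hsub hw
    have hmw := hT.isMatchingOn.mem hwT
    exact Finset.mem_erase.2 ⟨fun h => hvT (h ▸ hmw),
      hcl v w _ (Finset.mem_of_mem_erase hw) (hT.subset hmw) (hT.isMatchingOn.adj w hwT)⟩
  · intro K hK
    obtain ⟨v₀, hv₀, rfl⟩ := Finset.mem_image.1 hK
    simp [comp, Finset.filter_subset]
  · intro K hK K' hK' v hv hv'
    obtain ⟨v₀, hv₀, rfl⟩ := Finset.mem_image.1 hK
    obtain ⟨v₁, hv₁, rfl⟩ := Finset.mem_image.1 hK'
    rw [Finset.mem_filter] at hv hv'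
    exact hcomp _ _ (hv.2.trans hv'.2.symm)
  · intro K hK a ha b hb hab
    obtain ⟨v₀, hv₀, rfl⟩ := Finset.mem_image.1 hK
    exact Or.inl (hcl _ _ _ ha hb hab)
  · obtain ⟨T, m, hT⟩ := exists_isMaxMatching G S
    refine ⟨T, hT.subset, ⟨m, hT.isMatchingOn⟩, ?_⟩
    have h1 : (S \ T).card ≤ (S.image comp).card := by
      refine Finset.card_le_card_of_injOn comp
        (fun v hv => Finset.mem_image_of_mem _ (Finset.mem_sdiff.1 hv).1) fun x hx y hy hxy => ?_
      rw [Finset.mem_coe, Finset.mem_sdiff] at hx hy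
      have h2 : y ∈ comp x := hxy ▸ hmem y hy.1
      rcases hR x y hx.1 (Finset.mem_filter.1 h2).2 with h | h
      · exact h
      · exact ((h T m hT).elim hx.2 hy.2).elim
    have h3 := Finset.card_sdiff_add_card_eq_card hT.subset
    simp only [Finset.card_empty]
    omega

theorem exists_isGallaiEdmonds [Fintype V] (G : SimpleGraph V) (S : Finset V) :
    ∃ U 𝒦, IsGallaiEdmonds G S U 𝒦 := by
  induction hk : S.card generalizing S with
  | zero =>
    refine ⟨∅, isGallaiEdmonds_of_forall_missed fun v hv => ?_⟩
    simp [Finset.card_eq_zero.1 hk] at hv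
  | succ k ih =>
    by_cases hS : ∀ v ∈ S, ∃ T m, IsMaxMatching G S T m ∧ v ∉ T
    · exact ⟨∅, isGallaiEdmonds_of_forall_missed hS⟩
    push Not at hS
    obtain ⟨v, hv, hvT⟩ := hS
    obtain ⟨U, 𝒦, h⟩ := ih (S.erase v) (by rw [Finset.card_erase_of_mem hv, hk]; rfl)
    obtain ⟨T, m, hT⟩ := exists_isMaxMatching G S
    obtain ⟨T', hT'S, hT', hcard⟩ := h.matching
    have hvU : v ∉ U := fun hU => by simpa using h.subset hU
    have hT'S' := hT'S.trans (Finset.erase_subset v S)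
    -- every maximum matching of `S` covers `v`, and both sizes are even
    have hlt : T'.card + 2 ≤ T.card := by
      have h1 := hT.max T' hT'S' hT'
      have h2 : T'.card ≠ T.card := by
        intro he
        obtain ⟨m', hm'⟩ := hT'
        exact absurd (hT'S (hvT T' m' ⟨hm', hT'S', fun A hA hA' => he ▸ hT.max A hA hA'⟩)) (by simp)
      have h3 := hT'.even_card
      have h4 := Matchable.even_card ⟨m, hT.isMatchingOn⟩
      grind
    refine ⟨insert v U, 𝒦, Finset.insert_subset hv (h.subset.trans (Finset.erase_subset v S)), ?_,
      h.critical, ?_, h.eq_of_mem, ?_, T, hT.subset, ⟨m, hT.isMatchingOn⟩, ?_⟩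
    · intro w hw
      by_cases hwv : w = v
      · simp [hwv]
      · simpa [hwv] using h.cover w (by simp [hwv, hw])
    · intro K hK w hw
      have := h.part K hK hw
      simp only [Finset.mem_sdiff, Finset.mem_erase] at this
      simp [this]
    · intro K hK a ha b hb hab
      by_cases hbv : b = v
      · simp [hbv]
      · simpa [hbv] using h.closed K hK a ha b (by simp [hbv, hb]) hab
    · rw [Finset.card_erase_of_mem hv] at hcard
      rw [Finset.card_insert_of_notMem hvU]
      omega

/-- The nodes of `U` that have a neighbour in a member of `𝒮`. -/
noncomputable def nbrs (G : SimpleGraph V) (U : Finset V) (𝒮 : Finset (Finset V)) : Finset V :=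
  U.filter fun u => ∃ K ∈ 𝒮, ∃ a ∈ K, G.Adj u a

/-- Each member of `𝒮` has an odd number of nodes, so the matching either misses one of them or
joins one of them to a node of `U`. -/
lemma IsGallaiEdmonds.card_add_card_le {S U : Finset V} {𝒦 𝒮 : Finset (Finset V)}
    (h : IsGallaiEdmonds G S U 𝒦) (h𝒮 : 𝒮 ⊆ 𝒦) :
    𝒮.card + U.card ≤ 𝒦.card + (nbrs G U 𝒮).card := by
  obtain ⟨T, hTS, ⟨m, hm⟩, hcard⟩ := h.matching
  obtain rfl | ⟨K₀, hK₀⟩ := 𝒮.eq_empty_or_nonempty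
  · have := Finset.card_le_card hTS
    simp only [Finset.card_empty]
    omega
  have : Nonempty V := ⟨(h.critical K₀ (h𝒮 hK₀)).1.choose⟩
  have hex : ∀ K ∈ 𝒮, ∃ v ∈ K, v ∉ T ∨ (v ∈ T ∧ m v ∈ nbrs G U 𝒮) := by
    intro K hK
    by_contra! hc
    have hKT : K ⊆ T := fun v hv => by
      by_contra hvT
      exact hvT (hc v hv).1
    have hodd := (h.critical K (h𝒮 hK)).odd_card
    refine (Nat.not_even_iff_odd.2 hodd) (Matchable.even_card ⟨_, hm.restrict hKT fun v hv => ?_⟩)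
    have hadj := hm.adj v (hKT hv)
    refine (h.closed K (h𝒮 hK) v hv _ (hTS (hm.mem (hKT hv))) hadj).resolve_right fun hU => ?_
    exact (hc v hv).2 (hKT hv) (Finset.mem_filter.2 ⟨hU, K, hK, v, hv, hadj.symm⟩)
  choose! g hgK hg using hex
  have hgSU : ∀ K ∈ 𝒮, g K ∈ S ∧ g K ∉ U := fun K hK => by
    simpa using h.part K (h𝒮 hK) (hgK K hK)
  have h1 : 𝒮.card ≤ ((S \ T) ∪ nbrs G U 𝒮).card := by
    refine Finset.card_le_card_of_injOn (fun K => if g K ∈ T then m (g K) else g K)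
      (fun K hK => ?_) fun K hK K' hK' he => ?_
    · have := hg K hK
      have := hgSU K hK
      simp only [Finset.coe_union, Set.mem_union, Finset.mem_coe, Finset.mem_sdiff]
      split_ifs <;> grind
    · refine h.eq_of_mem K (h𝒮 hK) K' (h𝒮 hK') (g K) (hgK K hK) ?_
      have e1 := hg K hK
      have e2 := hg K' hK'
      have e3 := hgSU K hK
      have e4 := hgSU K' hK'
      have e5 := hm.invol (g K)
      have e6 := hm.invol (g K')
      have e7 := hgK K' hK'
      have e8 : ∀ x ∈ nbrs G U 𝒮, x ∈ U := fun x hx => (Finset.mem_filter.1 hx).1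
      simp only at he
      split_ifs at he <;> grind
  have h2 := Finset.card_union_le (S \ T) (nbrs G U 𝒮)
  have h3 := Finset.card_sdiff_add_card_eq_card hTS
  omega

end

section

variable {V : Type*} [Fintype V] {G : SimpleGraph V}

/-! ### Packings of edges and odd circuits -/

/-- A basic triangle-free 2-matching of `G` that covers precisely the nodes in `S`, each of them
with total value two. It is written as a symmetric function `f` of two nodes which gives the value
of the edge between them, and `0` to non-adjacent nodes. -/
structure IsPacking (G : SimpleGraph V) (S : Finset V) (f : V → V → ℕ) : Prop where
  symm : ∀ a b, f a b = f b a
  adj : ∀ a b, f a b ≠ 0 → G.Adj a b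
  mem : ∀ a b, f a b ≠ 0 → a ∈ S
  sum : ∀ a ∈ S, ∑ b, f a b = 2
  triangleFree : ∀ a b c, f a b ≠ 0 → f b c ≠ 0 → f c a = 0
  basic : ∃ 𝒞 : Set G.Subgraph,
    (∀ C ∈ 𝒞, ∃ (u : V) (p : G.Walk u u), p.IsCycle ∧ Odd p.length ∧ C = p.toSubgraph) ∧
    (∀ C ∈ 𝒞, ∀ C' ∈ 𝒞, C ≠ C' → Disjoint C.verts C'.verts) ∧
    (∀ C ∈ 𝒞, ∀ v ∈ C.verts, v ∈ S) ∧
    ∀ a b, f a b = 1 ↔ ∃ C ∈ 𝒞, C.Adj a b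

/-- `S` can be covered precisely by a basic triangle-free 2-matching, that is, by disjoint edges
and odd circuits of length at least five. -/
def Packable (G : SimpleGraph V) (S : Finset V) : Prop := ∃ f, IsPacking G S f

lemma IsPacking.union {S T : Finset V} {f g : V → V → ℕ} (hf : IsPacking G S f)
    (hg : IsPacking G T g) (hd : Disjoint S T) :
    IsPacking G (S ∪ T) (fun a b => f a b + g a b) := by
  rw [Finset.disjoint_left] at hd
  have ef : ∀ a b, a ∈ T → f a b = 0 := fun a b ha => by
    by_contra h
    exact hd (hf.mem a b h) ha
  have eg : ∀ a b, a ∈ S → g a b = 0 := fun a b ha => by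
    by_contra h
    exact hd ha (hg.mem a b h)
  refine ⟨fun a b => by rw [hf.symm, hg.symm], fun a b h => ?_, fun a b h => ?_, fun a ha => ?_,
    fun a b c h h' => ?_, ?_⟩
  · have := hf.adj a b
    have := hg.adj a b
    grind
  · have := hf.mem a b
    have := hg.mem a b
    grind
  · rcases Finset.mem_union.1 ha with ha | ha
    · simpa [eg a _ ha] using hf.sum a ha
    · simpa [ef a _ ha] using hg.sum a ha
  · have h1 := hf.mem a b
    have h2 := hf.mem b c
    have h3 := hg.mem a b
    have h4 := hg.mem b c
    have h5 := hf.triangleFree a b c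
    have h6 := hg.triangleFree a b c
    have h7 := hf.symm a b
    have h8 := hg.symm a b
    have h9 := hf.symm c a
    have h10 := hg.symm c a
    have := ef a b
    have := ef a c
    have := ef b a
    have := ef b c
    have := eg a b
    have := eg a c
    have := eg b a
    have := eg b c
    grind
  · obtain ⟨𝒞, h1, h2, h3, h4⟩ := hf.basic
    obtain ⟨𝒟, k1, k2, k3, k4⟩ := hg.basic
    have hdisj : ∀ C ∈ 𝒞, ∀ D ∈ 𝒟, Disjoint C.verts D.verts := fun C hC D hD =>
      Set.disjoint_left.2 fun v hv hv' => hd (h3 C hC v hv) (k3 D hD v hv')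
    refine ⟨𝒞 ∪ 𝒟, ?_, ?_, ?_, fun a b => ?_⟩
    · rintro C (hC | hC)
      exacts [h1 C hC, k1 C hC]
    · rintro C (hC | hC) C' (hC' | hC') hne
      exacts [h2 C hC C' hC' hne, hdisj C hC C' hC', (hdisj C' hC' C hC).symm, k2 C hC C' hC' hne]
    · rintro C (hC | hC) v hv
      exacts [Finset.mem_union_left _ (h3 C hC v hv), Finset.mem_union_right _ (k3 C hC v hv)]
    · simp only [Set.mem_union, or_and_right, exists_or]
      rw [← h4, ← k4]
      have := hf.mem a b
      have := ef a b
      have := eg a b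
      grind

lemma Packable.union {S T : Finset V} (h : Packable G S) (h' : Packable G T) (hd : Disjoint S T) :
    Packable G (S ∪ T) :=
  ⟨_, h.choose_spec.union h'.choose_spec hd⟩

lemma Packable.empty : Packable G ∅ :=
  ⟨fun _ _ => 0, by simp, by simp, by simp, by simp, by simp, ∅, by simp⟩

lemma Packable.pair {a b : V} (h : G.Adj a b) : Packable G {a, b} := by
  refine ⟨fun x y => if s(x, y) = s(a, b) then 2 else 0, fun x y => by rw [Sym2.eq_swap],
    fun x y hxy => ?_, fun x y hxy => ?_, fun x hx => ?_, fun x y z h1 h2 => ?_,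
    ∅, by simp, by simp, by simp, fun x y => by split_ifs <;> simp⟩
  · rw [← SimpleGraph.mem_edgeSet]
    have : s(x, y) = s(a, b) := by grind
    rw [this]
    exact h
  · simp at hxy
    simp
    tauto
  · rw [Finset.mem_insert, Finset.mem_singleton] at hx
    have hne := h.ne
    rcases hx with rfl | rfl
    · rw [Finset.sum_eq_single b] <;> simp +contextual [hne]
    · rw [Finset.sum_eq_single a] <;> simp +contextual [hne.symm]
  · have hne := h.ne
    simp at h1 h2 ⊢
    grind

lemma Matchable.packable {S : Finset V} (h : Matchable G S) : Packable G S := by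
  induction hk : S.card using Nat.strong_induction_on generalizing S with
  | _ k ih =>
    obtain rfl | ⟨v, hv⟩ := S.eq_empty_or_nonempty
    · exact .empty
    obtain ⟨m, hm⟩ := h
    have hsub : {v, m v} ⊆ S := by simp [Finset.insert_subset_iff, hv, hm.mem hv]
    have h1 : Matchable G (S \ {v, m v}) := ⟨_, hm.restrict_sdiff fun w hw => by
      rw [Finset.mem_insert, Finset.mem_singleton] at hw ⊢
      rcases hw with rfl | rfl
      · exact Or.inr rfl
      · exact Or.inl (hm.invol v)⟩
    have h2 := ih _ (by rw [← hk]; exact Finset.card_lt_card (Finset.sdiff_ssubset hsub ⟨v, by simp⟩))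
      h1 rfl
    have := h2.union (.pair (hm.adj v hv)) Finset.sdiff_disjoint
    rwa [Finset.sdiff_union_of_subset hsub] at this

lemma Packable.cycle {u : V} {p : G.Walk u u} (hp : p.IsCycle) (hodd : Odd p.length)
    (htri : ∀ a b c, p.toSubgraph.Adj a b → p.toSubgraph.Adj b c → ¬ p.toSubgraph.Adj c a)
    {Z : Finset V} (hZ : ∀ v, v ∈ Z ↔ v ∈ p.support) : Packable G Z := by
  refine ⟨fun a b => if p.toSubgraph.Adj a b then 1 else 0, fun a b => ?_, fun a b h => ?_,
    fun a b h => ?_, fun a ha => ?_, fun a b c h h' => ?_, {p.toSubgraph}, ?_, ?_, ?_, ?_⟩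
  · simp [p.toSubgraph.adj_comm a b]
  · have : p.toSubgraph.Adj a b := by simpa using h
    exact this.adj_sub
  · have : p.toSubgraph.Adj a b := by simpa using h
    exact (hZ a).2 (by simpa using p.toSubgraph.edge_vert this)
  · have h2 := hp.ncard_neighborSet_toSubgraph_eq_two ((hZ a).1 ha)
    rw [← Finset.card_filter, ← h2, Set.ncard_eq_toFinset_card']
    congr 1
    ext b
    simp
  · simpa using htri a b c (by simpa using h) (by simpa using h')
  · rintro C rfl
    exact ⟨u, p, hp, hodd, rfl⟩
  · rintro C rfl C' rfl h
    exact (h rfl).elim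
  · rintro C rfl v hv
    exact (hZ v).2 (by simpa using hv)
  · simp

/-- The symmetric difference of a matching `m` that misses only `p` and a matching `m'` that misses
only `u`, together with the edge `pu`, consists of circuits. The one through `pu` is odd; it is no
triangle unless `m u = m' p`, and `m` matches the nodes outside it. -/
theorem packable_of_adj {K : Finset V} {p u : V} {m m' : V → V} (hp : p ∈ K) (hu : u ∈ K)
    (hm : IsMatchingOn G (K.erase p) m) (hm' : IsMatchingOn G (K.erase u) m') (hpu : G.Adj p u)
    (hne : m u ≠ m' p) : Packable G K := by
  have hpu' := hpu.ne
  have hmp : m p = p := hm.fix p (by simp)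
  have hmu : m' u = u := hm'.fix u (by simp)
  have hinv := hm.invol
  have hinv' := hm'.invol
  have hK : ∀ v ∉ K, m v = v := fun v hv => hm.fix v (by simp [hv])
  have hK' : ∀ v ∉ K, m' v = v := fun v hv => hm'.fix v (by simp [hv])
  have hadj : ∀ v, v ∈ K → v ≠ p → G.Adj v (m v) := fun v hv hvp => hm.adj v (by simp [hv, hvp])
  have hadj' : ∀ v, v ∈ K → v ≠ u → G.Adj v (m' v) := fun v hv hvu => hm'.adj v (by simp [hv, hvu])
  have hnem : ∀ v, v ∈ K → v ≠ p → m v ≠ v := fun v hv hvp => (hadj v hv hvp).ne'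
  have hnem' : ∀ v, v ∈ K → v ≠ u → m' v ≠ v := fun v hv hvp => (hadj' v hv hvp).ne'
  let C : SimpleGraph V :=
    { Adj := fun a b => a ≠ b ∧ (m a = b ∧ m' a ≠ b ∨ m' a = b ∧ m a ≠ b ∨ a = p ∧ b = u ∨
        a = u ∧ b = p)
      symm := ⟨fun a b h => by
        have := hinv a
        have := hinv' a
        have := hinv b
        have := hinv' b
        grind⟩
      loopless := ⟨fun a h => h.1 rfl⟩ }
  have hCadj : ∀ a b, C.Adj a b ↔ a ≠ b ∧ (m a = b ∧ m' a ≠ b ∨ m' a = b ∧ m a ≠ b ∨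
      a = p ∧ b = u ∨ a = u ∧ b = p) := fun _ _ => Iff.rfl
  have hCG : C ≤ G := by
    intro a b h
    rw [hCadj] at h
    have := hadj a
    have := hadj' a
    have := hK a
    have := hK' a
    have := hpu.symm
    grind
  have hCK : ∀ a b, C.Adj a b → a ∈ K := by
    intro a b h
    rw [hCadj] at h
    have := hK a
    have := hK' a
    grind
  have hup : m' p ≠ u := fun h => hpu' (by rw [← hinv' p, h, hmu])
  have hpu2 : m u ≠ p := fun h => hpu' (by rw [← hinv u, h, hmp])
  have hCp : ∀ b, C.Adj p b ↔ b = u ∨ b = m' p := fun b => by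
    have := hnem' p hp hpu'
    rw [hCadj]
    grind
  have hCu : ∀ b, C.Adj u b ↔ b = p ∨ b = m u := fun b => by
    have := hnem u hu hpu'.symm
    rw [hCadj]
    grind
  have hCv : ∀ a b, a ≠ p → a ≠ u → (C.Adj a b ↔ m a ≠ m' a ∧ (b = m a ∨ b = m' a)) :=
    fun a b hap hau => by
      have := hnem a
      have := hnem' a
      have := hK a
      have := hK' a
      rw [hCadj]
      grind
  have hcyc : C.IsCycles := by
    rintro v ⟨w, hw⟩
    rw [SimpleGraph.mem_neighborSet] at hw
    by_cases hvp : v = p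
    · have : C.neighborSet v = {u, m' p} := by
        ext b
        simp [hvp, hCp]
      rw [this, Set.ncard_pair hup.symm]
    by_cases hvu : v = u
    · have : C.neighborSet v = {p, m u} := by
        ext b
        simp [hvu, hCu]
      rw [this, Set.ncard_pair hpu2.symm]
    · have h1 := (hCv v w hvp hvu).1 hw
      have : C.neighborSet v = {m v, m' v} := by
        ext b
        simp [hCv v b hvp hvu, h1.1]
      rw [this, Set.ncard_pair h1.1]
  have htri : ∀ a b c, C.Adj a b → C.Adj b c → ¬ C.Adj c a := by
    intro a b c h1 h2 h3
    rw [hCadj] at h1 h2 h3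
    have := hinv a
    have := hinv b
    have := hinv c
    have := hinv' a
    have := hinv' b
    have := hinv' c
    grind
  obtain ⟨q, hq, hqv⟩ := hcyc.exists_cycle_toSubgraph_verts_eq_connectedComponentSupp
    (c := C.connectedComponentMk p) (v := p) rfl ⟨u, (hCp u).2 (Or.inl rfl)⟩
  let Z : Finset V := Finset.univ.filter (C.Reachable p)
  have hZ : ∀ v, v ∈ Z ↔ C.Reachable p v := fun v => by simp [Z]
  have hZsupp : ∀ v, v ∈ Z ↔ v ∈ q.support := by
    intro v
    rw [← SimpleGraph.Walk.mem_verts_toSubgraph, hqv, hZ, SimpleGraph.ConnectedComponent.mem_supp_iff,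
      SimpleGraph.ConnectedComponent.eq]
    exact SimpleGraph.reachable_comm
  have hZC : ∀ v w, v ∈ Z → C.Adj v w → w ∈ Z := fun v w hv hvw => by
    rw [hZ] at hv ⊢
    exact hv.trans hvw.reachable
  have hZK : Z ⊆ K := by
    intro v hv
    have h1 : v ∈ q.toSubgraph.verts := by simpa using (hZsupp v).1 hv
    have h2 := hq.ncard_neighborSet_toSubgraph_eq_two ((hZsupp v).1 hv)
    obtain ⟨w, hw⟩ := Set.nonempty_of_ncard_ne_zero (s := q.toSubgraph.neighborSet v) (by omega)
    exact hCK v w (SimpleGraph.Subgraph.Adj.adj_sub hw)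
  have hpZ : p ∈ Z := (hZ p).2 SimpleGraph.Reachable.rfl
  -- a node of the circuit has two neighbours in `C`, and one of them is its partner under `m`
  have hZm : ∀ v ∈ Z, m v ∈ Z := by
    intro v hv
    by_cases hvp : v = p
    · rwa [hvp, hmp, ← hvp]
    refine hZC v _ hv ?_
    by_cases hvu : v = u
    · rw [hvu, hCu]
      exact Or.inr rfl
    have h2 := hq.ncard_neighborSet_toSubgraph_eq_two ((hZsupp v).1 hv)
    obtain ⟨w, hw⟩ := Set.nonempty_of_ncard_ne_zero (s := q.toSubgraph.neighborSet v) (by omega)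
    have h3 := (hCv v w hvp hvu).1 (SimpleGraph.Subgraph.Adj.adj_sub hw)
    exact (hCv v _ hvp hvu).2 ⟨h3.1, Or.inl rfl⟩
  have hodd : Odd q.length := by
    have h1 : Matchable G (Z.erase p) := ⟨_, hm.restrict (Finset.erase_subset_erase p hZK)
      fun v hv => by
        rw [Finset.mem_erase] at hv ⊢
        exact ⟨fun h => hv.1 (by rw [← hinv v, h, hmp]), hZm v hv.2⟩⟩
    have h2 : q.length = Z.card := by
      have h3 : q.support.tail.toFinset = Z := by
        ext v
        rw [List.mem_toFinset, hZsupp, q.mem_support_iff]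
        refine ⟨Or.inr, fun h => h.elim (fun h => ?_) id⟩
        rw [h]
        exact SimpleGraph.Walk.end_mem_tail_support hq.not_nil
      rw [← h3, List.toFinset_card_of_nodup hq.support_nodup, List.length_tail,
        SimpleGraph.Walk.length_support]
      rfl
    rw [h2, ← Finset.card_erase_add_one hpZ]
    exact h1.even_card.add_one
  have hrest : Matchable G (K \ Z) := by
    have h1 := hm.restrict_sdiff hZm
    have h2 : K.erase p \ Z = K \ Z := by
      ext v
      simp only [Finset.mem_sdiff, Finset.mem_erase]
      grind
    exact ⟨_, h2 ▸ h1⟩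
  have hsub : ∀ a b, (q.mapLe hCG).toSubgraph.Adj a b → C.Adj a b := by
    intro a b h
    have h1 : s(a, b) ∈ (q.mapLe hCG).edges := by
      rwa [SimpleGraph.Walk.adj_toSubgraph_iff_mem_edges] at h
    rw [SimpleGraph.Walk.edges_mapLe_eq_edges] at h1
    exact q.adj_of_mem_edges h1
  have hcircuit : Packable G Z := by
    refine Packable.cycle (p := q.mapLe hCG) ?_ ?_ (fun a b c h1 h2 h3 =>
      htri a b c (hsub _ _ h1) (hsub _ _ h2) (hsub _ _ h3)) (fun v => ?_)
    · exact hq.mapLe hCG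
    · simpa using hodd
    · simpa using hZsupp v
  have := hrest.packable.union hcircuit Finset.sdiff_disjoint
  rwa [Finset.sdiff_union_of_subset hZK] at this

end

section

variable {V : Type*} {G : SimpleGraph V}

/-! ### Trees of triangles -/

/-- A node set that arises from a single node by repeatedly attaching a triangle `puw` at a node
`p`, where `u` and `w` are new and have no neighbour but `p` among the old nodes. Such a set
induces a triangle cluster. -/
inductive TriangleTree (G : SimpleGraph V) : Finset V → Prop
  | single (v : V) : TriangleTree G {v}
  | attach (S : Finset V) (p u w : V) (hS : TriangleTree G S) (hp : p ∈ S) (hu : u ∉ S) (hw : w ∉ S)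
      (hpu : G.Adj p u) (huw : G.Adj u w) (hwp : G.Adj w p) (hSu : ∀ a ∈ S, G.Adj u a → a = p)
      (hSw : ∀ a ∈ S, G.Adj w a → a = p) : TriangleTree G (S ∪ {u, w})

lemma erase_union_pair {S : Finset V} {p u w : V} (hp : p ∈ S) (hu : u ∉ S) (hw : w ∉ S) :
    (S ∪ {u, w}).erase p = S.erase p ∪ {u, w} := by
  ext v
  simp only [Finset.mem_erase, Finset.mem_union, Finset.mem_insert, Finset.mem_singleton]
  grind

lemma union_pair_erase {S : Finset V} {p u w : V} (hp : p ∈ S) (hu : u ∉ S) (huw : u ≠ w) :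
    (S ∪ {u, w}).erase u = S.erase p ∪ {w, p} := by
  ext v
  simp only [Finset.mem_erase, Finset.mem_union, Finset.mem_insert, Finset.mem_singleton]
  grind

lemma TriangleTree.factorCritical {K : Finset V} (h : TriangleTree G K) : FactorCritical G K := by
  induction h with
  | single v => exact ⟨by simp, fun w hw => by simpa [Finset.mem_singleton.1 hw] using Matchable.empty⟩
  | attach S p u w hS hp hu hw hpu huw hwp hSu hSw ih =>
    refine ⟨⟨u, by simp⟩, fun x hx => ?_⟩
    by_cases hxS : x ∈ S
    · rw [erase_union_pair hxS hu hw]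
      exact (ih.2 x hxS).union (.pair huw) (by simp [hu, hw])
    · have hx' : x = u ∨ x = w := by simpa [hxS] using hx
      rcases hx' with rfl | rfl
      · rw [union_pair_erase hp hu huw.ne]
        exact (ih.2 p hp).union (.pair hwp) (by simp [hw])
      · rw [Finset.pair_comm, union_pair_erase hp hw huw.ne']
        exact (ih.2 p hp).union (.pair hpu.symm) (by simp [hu])

lemma packable_union_pair [Fintype V] {S : Finset V} {p p' u w : V} (hS : FactorCritical G S)
    (hp : p ∈ S) (hp' : p' ∈ S) (hpp' : p ≠ p') (hu : u ∉ S) (hw : w ∉ S)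
    (hpu : G.Adj p u) (huw : G.Adj u w) (hwp : G.Adj w p') : Packable G (S ∪ {u, w}) := by
  obtain ⟨m, hm⟩ := hS.2 p hp
  obtain ⟨m', hm'⟩ := hS.2 p' hp'
  have h1 := hm.union (isMatchingOn_swap huw) (by simp [hu, hw])
  have h2 := hm'.union (isMatchingOn_swap hwp) (by simp [hw])
  rw [← erase_union_pair hp hu hw] at h1
  rw [← union_pair_erase hp' hu huw.ne] at h2
  refine packable_of_adj (by simp [hp]) (by simp) h1 h2 hpu ?_
  have h3 : m w = w := hm.fix w (by simp [hw])
  have h4 : m' p ∈ S := Finset.mem_of_mem_erase (hm'.mem (by simp [hp, hpp']))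
  have h5 : p ≠ w := fun h => hw (h ▸ hp)
  simp only [Function.comp_apply, Equiv.swap_apply_left, Equiv.swap_apply_of_ne_of_ne h5 hpp', h3]
  exact fun h => hw (h ▸ h4)

/-- Grow a tree of triangles `S` inside `K` such that `K \ S` has a perfect matching `m`. An edge
`pu` that leaves `S` closes a triangle with `m u`, and neither `u` nor `m u` has another neighbour
in `S`, since otherwise there is an odd circuit of length at least five whose complement in `K` has
a perfect matching. -/
theorem FactorCritical.triangleTree [Fintype V] {K : Finset V} (hK : FactorCritical G K)
    (hnot : ¬ Packable G K) : TriangleTree G K := by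
  obtain ⟨v, hv⟩ := hK.1
  have key : ∀ n, ∀ S ⊆ K, TriangleTree G S → Matchable G (K \ S) → (K \ S).card = n →
      TriangleTree G K := by
    intro n
    induction n using Nat.strong_induction_on with
    | _ n ih =>
      intro S hSK hS hM hn
      obtain hKS | ⟨x, hx⟩ := (K \ S).eq_empty_or_nonempty
      · rwa [(Finset.sdiff_eq_empty_iff_subset.1 hKS).antisymm hSK]
      have hSc := hS.factorCritical
      obtain ⟨p, hp, u, huKS, hpu⟩ : ∃ p ∈ S, ∃ u ∈ K \ S, G.Adj p u := by
        by_contra! hc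
        rw [Finset.mem_sdiff] at hx
        obtain ⟨m, hm⟩ := hK.2 x hx.1
        have hsub : S ⊆ K.erase x := fun a ha =>
          Finset.mem_erase.2 ⟨fun h => hx.2 (h ▸ ha), hSK ha⟩
        refine (Nat.not_even_iff_odd.2 hSc.odd_card)
          (Matchable.even_card ⟨_, hm.restrict hsub fun a ha => ?_⟩)
        by_contra hma
        exact hc a ha (m a) (Finset.mem_sdiff.2
          ⟨Finset.mem_of_mem_erase (hm.mem (hsub ha)), hma⟩) (hm.adj a (hsub ha))
      obtain ⟨m, hm⟩ := hM
      have huw := hm.adj u huKS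
      have hwKS := hm.mem huKS
      obtain ⟨w, hw⟩ : ∃ w, w = m u := ⟨_, rfl⟩
      rw [← hw] at huw hwKS
      have hsub : {u, w} ⊆ K \ S := by simp only [Finset.insert_subset_iff, huKS, true_and,
        Finset.singleton_subset_iff, hwKS]
      have hM' : Matchable G (K \ (S ∪ {u, w})) := by
        have := hm.restrict_sdiff (T := {u, w}) fun a ha => by
          rw [Finset.mem_insert, Finset.mem_singleton] at ha ⊢
          rcases ha with rfl | rfl
          · exact Or.inr hw.symm
          · exact Or.inl (by rw [hw, hm.invol])
        rw [sdiff_sdiff_left] at this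
        exact ⟨_, this⟩
      have hsub' : S ∪ {u, w} ⊆ K := Finset.union_subset hSK (hsub.trans Finset.sdiff_subset)
      have hlt : (K \ (S ∪ {u, w})).card < n := by
        rw [← hn]
        refine Finset.card_lt_card ⟨Finset.sdiff_subset_sdiff le_rfl Finset.subset_union_left,
          fun h => ?_⟩
        simpa using h huKS
      rw [Finset.mem_sdiff] at huKS hwKS
      have hwp : G.Adj w p := by
        obtain ⟨m₁, hm₁⟩ := hSc.2 p hp
        obtain ⟨m₂, hm₂⟩ := hK.2 u huKS.1
        have h1 := hm.union hm₁ (Finset.disjoint_left.2 fun a ha ha' =>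
          (Finset.mem_sdiff.1 ha).2 (Finset.mem_of_mem_erase ha'))
        have h2 : K \ S ∪ S.erase p = K.erase p := by
          ext a
          simp only [Finset.mem_erase, Finset.mem_union, Finset.mem_sdiff]
          grind
        rw [h2] at h1
        have h3 : (m ∘ m₁) u = w := by
          rw [Function.comp_apply, hm₁.fix u (by simp [huKS.2]), hw]
        by_contra hc
        refine hnot (packable_of_adj (hSK hp) huKS.1 h1 hm₂ hpu fun h => hc ?_)
        rw [← h3, h]
        exact (hm₂.adj p (Finset.mem_erase.2 ⟨hpu.ne, hSK hp⟩)).symm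
      have hno : ¬ Packable G (S ∪ {u, w}) := fun h => hnot <| by
        have := hM'.packable.union h Finset.sdiff_disjoint
        rwa [Finset.sdiff_union_of_subset hsub'] at this
      refine ih _ hlt _ hsub' (.attach S p u w hS hp huKS.2 hwKS.2 hpu huw hwp
        (fun a ha hua => ?_) (fun a ha hwa => ?_)) hM' rfl
      · by_contra hne
        rw [Finset.pair_comm] at hno
        exact hno (packable_union_pair hSc hp ha (Ne.symm hne) hwKS.2 huKS.2 hwp.symm huw.symm hua)
      · by_contra hne
        exact hno (packable_union_pair hSc hp ha (Ne.symm hne) huKS.2 hwKS.2 hpu huw hwa)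
  refine key _ {v} (by simpa using hv) (.single v) ?_ rfl
  rw [Finset.sdiff_singleton_eq_erase]
  exact hK.2 v hv

/-! ### Trees of triangles are triangle clusters -/

/-- The triangles of a tree of triangles. That `v` separates `T` from `T'` is expressed by a set `A`
which contains `T` except for `v`, avoids `T'`, and is left by no edge except towards `v`. -/
lemma TriangleTree.exists_triangles {K : Finset V} (h : TriangleTree G K) :
    ∃ 𝒯 : Set (Finset V), (∀ T ∈ 𝒯, G.IsNClique 3 T ∧ T ⊆ K) ∧
      (∀ a ∈ K, ∀ b ∈ K, G.Adj a b → ∃! T, T ∈ 𝒯 ∧ a ∈ T ∧ b ∈ T) ∧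
      ∀ T ∈ 𝒯, ∀ T' ∈ 𝒯, T ≠ T' → ∀ v ∈ T, v ∈ T' → ∃ A ⊆ K, v ∉ A ∧
        (∀ a ∈ A, ∀ b ∈ K, b ≠ v → G.Adj a b → b ∈ A) ∧ (∀ a ∈ T, a ≠ v → a ∈ A) ∧
        ∀ b ∈ T', b ∉ A := by
  induction h with
  | single v =>
    refine ⟨∅, by simp, fun a ha b hb hab => ?_, by simp⟩
    rw [Finset.mem_singleton] at ha hb
    exact (hab.ne (ha.trans hb.symm)).elim
  | attach S p u w hS hp hu hw hpu huw hwp hSu hSw ih =>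
    obtain ⟨𝒯, h1, h2, h3⟩ := ih
    have hsub : ∀ T ∈ 𝒯, ∀ a ∈ T, a ∈ S := fun T hT a ha => (h1 T hT).2 ha
    have hSu' : ∀ a ∈ S, G.Adj a u → a = p := fun a ha h => hSu a ha h.symm
    have hSw' : ∀ a ∈ S, G.Adj a w → a = p := fun a ha h => hSw a ha h.symm
    have hT₀ : ({p, u, w} : Finset V) ∉ 𝒯 := fun h => hu (hsub _ h u (by simp))
    refine ⟨insert {p, u, w} 𝒯, ?_, fun a ha b hb hab => ?_, ?_⟩
    · rintro T (rfl | hT)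
      · refine ⟨SimpleGraph.is3Clique_triple_iff.2 ⟨hpu, hwp.symm, huw⟩, fun a ha => ?_⟩
        simp only [Finset.mem_insert, Finset.mem_singleton, Finset.mem_union] at ha ⊢
        grind
      · exact ⟨(h1 T hT).1, (h1 T hT).2.trans Finset.subset_union_left⟩
    · by_cases hold : a ∈ S ∧ b ∈ S
      · obtain ⟨T, hT, hu'⟩ := h2 a hold.1 b hold.2 hab
        refine ⟨T, ⟨Or.inr hT.1, hT.2⟩, ?_⟩
        rintro T' ⟨rfl | hT', ha', hb'⟩
        · have := hab.ne
          simp only [Finset.mem_insert, Finset.mem_singleton] at ha' hb'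
          grind
        · exact hu' T' ⟨hT', ha', hb'⟩
      · have := hab.ne
        refine ⟨{p, u, w}, ⟨Or.inl rfl, ?_⟩, ?_⟩
        · have := hSu a
          have := hSw a
          have := hSu' a
          have := hSw' a
          have := hSu b
          have := hSw b
          have := hSu' b
          have := hSw' b
          simp only [Finset.mem_insert, Finset.mem_singleton, Finset.mem_union] at ha hb ⊢
          grind
        · rintro T' ⟨rfl | hT', ha', hb'⟩
          · rfl
          · exact (hold ⟨hsub _ hT' a ha', hsub _ hT' b hb'⟩).elim
    · rintro T (rfl | hT) T' (rfl | hT') hne v hv hv'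
      · exact (hne rfl).elim
      · have hvS := hsub _ hT' v hv'
        have hvp : v = p := by
          simp only [Finset.mem_insert, Finset.mem_singleton] at hv
          grind
        subst hvp
        refine ⟨{u, w}, Finset.subset_union_right, by grind, fun a ha b hb hbv hab => ?_, by grind,
          fun b hb => by grind⟩
        refine (Finset.mem_union.1 hb).resolve_left fun hbS => hbv ?_
        rw [Finset.mem_insert, Finset.mem_singleton] at ha
        rcases ha with rfl | rfl
        exacts [hSu b hbS hab, hSw b hbS hab]
      · have hvS := hsub _ hT v hv
        have hvp : v = p := by
          simp only [Finset.mem_insert, Finset.mem_singleton] at hv'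
          grind
        subst hvp
        refine ⟨S.erase v, (Finset.erase_subset _ _).trans Finset.subset_union_left, by simp,
          fun a ha b hb hbv hab => ?_, fun a ha hav => by simp [hav, hsub _ hT a ha],
          fun b hb => by grind⟩
        simp only [Finset.mem_insert, Finset.mem_singleton, Finset.mem_union, Finset.mem_erase]
          at ha hb ⊢
        refine ⟨hbv, hb.resolve_right ?_⟩
        rintro (rfl | rfl)
        · exact ha.1 (hSu' a ha.2 hab)
        · exact ha.1 (hSw' a ha.2 hab)
      · obtain ⟨A, hAS, hvA, hA, hTA, hT'A⟩ := h3 T hT T' hT' hne v hv hv'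
        -- the new nodes lie on the same side of `v` as the node `p` to which they are attached
        refine ⟨if p ∈ A then A ∪ {u, w} else A, ?_, ?_, fun a ha b hb hbv hab => ?_,
          fun a ha hav => ?_, fun b hb => ?_⟩
        · split_ifs
          · exact Finset.union_subset_union_left hAS
          · exact hAS.trans Finset.subset_union_left
        · have hvS := hsub T hT v hv
          have hvu : v ≠ u := fun h => hu (h ▸ hvS)
          have hvw : v ≠ w := fun h => hw (h ▸ hvS)
          split_ifs <;> simp [hvu, hvw, hvA]
        · by_cases haA : a ∈ A
          · have haS := hAS haA
            rcases Finset.mem_union.1 hb with hb | hb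
            · have := hA a haA b hb hbv hab
              split_ifs <;> simp [this]
            · have hap : a = p := by
                rw [Finset.mem_insert, Finset.mem_singleton] at hb
                rcases hb with rfl | rfl
                exacts [hSu' a haS hab, hSw' a haS hab]
              rw [if_pos (hap ▸ haA)]
              exact Finset.mem_union_right _ hb
          · have hpA : p ∈ A := by
              by_contra hpA
              exact haA (by simpa [hpA] using ha)
            rw [if_pos hpA] at ha ⊢
            have ha' : a = u ∨ a = w := by simpa [haA] using ha
            rcases Finset.mem_union.1 hb with hbS | hb
            · have hbp : b = p := by
                rcases ha' with rfl | rfl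
                exacts [hSu b hbS hab, hSw b hbS hab]
              exact Finset.mem_union_left _ (hbp ▸ hpA)
            · exact Finset.mem_union_right _ hb
        · have := hTA a ha hav
          split_ifs <;> simp [this]
        · have := hT'A b hb
          have hbS := hsub T' hT' b hb
          have hbu : b ≠ u := fun h => hu (h ▸ hbS)
          have hbw : b ≠ w := fun h => hw (h ▸ hbS)
          split_ifs <;> simp [hbu, hbw, this]

lemma TriangleTree.isTriangleCluster {W : Type*} {H : SimpleGraph W} {K : Finset V}
    (h : TriangleTree G K) (hH : H.Connected) (f : W ↪ V) (hf : ∀ v, v ∈ K ↔ ∃ a, f a = v)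
    (hadj : ∀ a b, H.Adj a b ↔ G.Adj (f a) (f b)) : IsTriangleCluster H := by
  obtain ⟨𝒯, h1, h2, h3⟩ := h.exists_triangles
  refine ⟨hH, {T | T.map f ∈ 𝒯}, fun T hT => ?_, fun a b hab => ?_, fun T hT T' hT' hne => ?_⟩
  · obtain ⟨hc, hcard⟩ := SimpleGraph.isNClique_iff G |>.1 (h1 _ hT).1
    refine (SimpleGraph.isNClique_iff H).2 ⟨fun a ha b hb hne => ?_, by simpa using hcard⟩
    exact (hadj a b).2 (hc (by simpa using ha) (by simpa using hb) (f.injective.ne hne))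
  · obtain ⟨T, hT, huniq⟩ := h2 (f a) ((hf _).2 ⟨a, rfl⟩) (f b) ((hf _).2 ⟨b, rfl⟩) ((hadj a b).1 hab)
    obtain ⟨T₀, rfl⟩ : ∃ T₀ : Finset W, T₀.map f = T := by
      refine ⟨T.preimage f f.injective.injOn, ?_⟩
      rw [Finset.map_eq_image, Finset.image_preimage, Finset.filter_true_of_mem]
      exact fun v hv => (hf v).1 ((h1 T hT.1).2 hv)
    refine ⟨T₀, by simpa using hT, fun T' hT' => ?_⟩
    exact Finset.map_injective f (huniq _ (by simpa using hT'))
  · have h4 := fun v (hv : v ∈ T) (hv' : v ∈ T') => h3 _ hT _ hT' ((Finset.map_injective f).ne hne) (f v)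
      (by simpa using hv) (by simpa using hv')
    refine ⟨fun x hx y hy => ?_, fun v hv a b ha hb haT hbT hab => ?_⟩
    · obtain ⟨A, -, -, -, hTA, hT'A⟩ := h4 x hx.1 hx.2
      by_contra hxy
      exact hT'A (f y) (by simpa using hy.2)
        (hTA (f y) (by simpa using hy.1) (f.injective.ne (Ne.symm hxy)))
    · obtain ⟨A, -, -, hA, hTA, hT'A⟩ := h4 v hv.1 hv.2
      refine hT'A (f b) (by simpa using hbT) ?_
      have hreach : ∀ x y : {w : W | w ≠ v}, (H.induce {w : W | w ≠ v}).Reachable x y →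
          f x ∈ A → f y ∈ A := by
        rintro x y ⟨q⟩ hx
        induction q with
        | nil => exact hx
        | @cons x z y hxz q ih =>
          exact ih (hA _ hx _ ((hf _).2 ⟨_, rfl⟩) (f.injective.ne z.2) ((hadj _ _).1 hxz))
      exact hreach _ _ hab (hTA (f a) (by simpa using haT) (f.injective.ne ha))

lemma TriangleTree.rel {K : Finset V} (h : TriangleTree G K) {r : V → V → Prop}
    (hr : ∀ a ∈ K, r a a) (hr' : ∀ a b c, r a b → r b c → r a c)
    (hadj : ∀ a ∈ K, ∀ b ∈ K, G.Adj a b → r a b) : ∀ a ∈ K, ∀ b ∈ K, r a b := by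
  induction h with
  | single v =>
    intro a ha b hb
    rw [Finset.mem_singleton.1 (hb), Finset.mem_singleton.1 (ha)]
    exact hr v (by simp)
  | attach S p u w hS hp hu hw hpu huw hwp hSu hSw ih =>
    have ihS := ih (fun a ha => hr a (by simp [ha]))
      fun a ha b hb => hadj a (by simp [ha]) b (by simp [hb])
    have hp' : p ∈ S ∪ {u, w} := by simp [hp]
    have h1 : ∀ a ∈ S ∪ {u, w}, r a p ∧ r p a := by
      intro a ha
      by_cases haS : a ∈ S
      · exact ⟨ihS a haS p hp, ihS p hp a haS⟩
      have ha' : a = u ∨ a = w := by simpa [haS] using ha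
      have hap : G.Adj a p := by
        rcases ha' with rfl | rfl
        exacts [hpu.symm, hwp]
      exact ⟨hadj a ha p hp' hap, hadj p hp' a ha hap.symm⟩
    exact fun a ha b hb => hr' a p b (h1 a ha).1 (h1 b hb).2

lemma card_le_clusterCount [Fintype V] {U : Finset V} {𝒮 : Finset (Finset V)}
    (htree : ∀ K ∈ 𝒮, TriangleTree G K) (hU : ∀ K ∈ 𝒮, ∀ a ∈ K, a ∉ U)
    (hdisj : ∀ K ∈ 𝒮, ∀ K' ∈ 𝒮, ∀ v ∈ K, v ∈ K' → K = K')
    (hclosed : ∀ K ∈ 𝒮, ∀ a ∈ K, ∀ b ∉ U, G.Adj a b → b ∈ K) :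
    𝒮.card ≤ clusterCount (removeNodes G U) := by
  have hne : ∀ K ∈ 𝒮, ∃ x : {v : V | v ∉ U}, x.1 ∈ K := fun K hK => by
    obtain ⟨a, ha⟩ := (htree K hK).factorCritical.1
    exact ⟨⟨a, hU K hK a ha⟩, ha⟩
  have hcl : ∀ K ∈ 𝒮, ∀ x y : {v : V | v ∉ U}, (removeNodes G U).Reachable x y → x.1 ∈ K →
      y.1 ∈ K := by
    rintro K hK x y ⟨q⟩ hx
    induction q with
    | nil => exact hx
    | @cons x z y hxz q ih => exact ih (hclosed K hK _ hx _ z.2 hxz)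
  have hreach : ∀ K ∈ 𝒮, ∀ x y : {v : V | v ∉ U}, x.1 ∈ K → y.1 ∈ K →
      (removeNodes G U).Reachable x y := by
    intro K hK x y hx hy
    have := (htree K hK).rel
      (r := fun a b => ∃ (ha : a ∉ U) (hb : b ∉ U), (removeNodes G U).Reachable ⟨a, ha⟩ ⟨b, hb⟩)
      (fun a ha => ⟨hU K hK a ha, hU K hK a ha, .rfl⟩)
      (fun a b c ⟨ha, hb, hab⟩ ⟨hb', hc, hbc⟩ => ⟨ha, hc, hab.trans hbc⟩)
      (fun a ha b hb hab => ⟨hU K hK a ha, hU K hK b hb,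
        SimpleGraph.Adj.reachable (G := removeNodes G U) hab⟩) x.1 hx y.1 hy
    obtain ⟨_, _, h⟩ := this
    exact h
  choose x hx using hne
  have hcluster : ∀ K (hK : K ∈ 𝒮), IsTriangleCluster
      ((removeNodes G U).connectedComponentMk (x K hK)).toSimpleGraph := by
    intro K hK
    refine (htree K hK).isTriangleCluster (SimpleGraph.ConnectedComponent.connected_toSimpleGraph _)
      ⟨fun a => a.1.1, fun a b h => Subtype.ext (Subtype.ext h)⟩ (fun v => ⟨fun hv => ?_, ?_⟩)
      fun a b => Iff.rfl
    · exact ⟨⟨⟨v, hU K hK v hv⟩, SimpleGraph.ConnectedComponent.eq.2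
        (hreach K hK ⟨v, hU K hK v hv⟩ (x K hK) hv (hx K hK))⟩, rfl⟩
    · rintro ⟨⟨a, ha⟩, rfl⟩
      exact hcl K hK _ _ (SimpleGraph.ConnectedComponent.eq.1 ha).symm (hx K hK)
  rw [clusterCount, ← Nat.card_coe_set_eq, ← Fintype.card_coe, ← Nat.card_eq_fintype_card]
  refine Nat.card_le_card_of_injective
    (fun K : 𝒮 => ⟨(removeNodes G U).connectedComponentMk (x K.1 K.2), hcluster K.1 K.2⟩)
    fun K K' h => Subtype.ext ?_
  have h1 := SimpleGraph.ConnectedComponent.eq.1 (congrArg Subtype.val h)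
  exact hdisj _ K.2 _ K'.2 (x K'.1 K'.2).1 (hcl _ K.2 _ _ h1 (hx _ K.2)) (hx _ K'.2)

end

section

variable {V : Type*} {G : SimpleGraph V}

/-! ### 2-matchings as symmetric weights -/

/-- The value of `x` on the edge between two nodes, and `0` for non-adjacent nodes. -/
noncomputable def weight (x : G.edgeSet → ℕ) (a b : V) : ℕ :=
  if h : G.Adj a b then x ⟨s(a, b), h⟩ else 0

lemma weight_comm (x : G.edgeSet → ℕ) (a b : V) : weight x a b = weight x b a := by
  simp only [weight, G.adj_comm a b, Sym2.eq_swap]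

lemma adj_of_weight_ne_zero {x : G.edgeSet → ℕ} {a b : V} (h : weight x a b ≠ 0) : G.Adj a b := by
  by_contra hc
  simp [weight, hc] at h

lemma finsum_incident_eq [Fintype V] (x : G.edgeSet → ℕ) (v : V) :
    (∑ᶠ (e : G.edgeSet) (_ : v ∈ e.1), x e) = ∑ e : G.edgeSet, if v ∈ e.1 then x e else 0 := by
  rw [finsum_eq_sum_of_fintype]
  exact Finset.sum_congr rfl fun e _ => finsum_eq_if

lemma finsum_incident_eq_sum_weight [Fintype V] (x : G.edgeSet → ℕ) (v : V) :
    (∑ᶠ (e : G.edgeSet) (_ : v ∈ e.1), x e) = ∑ b, weight x v b := by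
  have h1 : ∀ e : G.edgeSet, (if v ∈ e.1 then x e else 0) =
      ∑ b, if s(v, b) = e.1 then x e else 0 := by
    intro e
    split_ifs with h
    · obtain ⟨c, hc⟩ := h
      rw [Finset.sum_eq_single c, if_pos hc.symm]
      · intro b _ hb
        rw [if_neg]
        rw [hc, Sym2.congr_right]
        exact hb
      · simp
    · refine (Finset.sum_eq_zero fun b _ => if_neg fun hb => h ?_).symm
      rw [← hb]
      exact Sym2.mem_mk_left v b
  have h2 : ∀ b, weight x v b = ∑ e : G.edgeSet, if s(v, b) = e.1 then x e else 0 := by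
    intro b
    by_cases h : G.Adj v b
    · rw [weight, dif_pos h, Finset.sum_eq_single ⟨s(v, b), h⟩, if_pos rfl]
      · exact fun e _ he => if_neg fun h' => he (Subtype.ext h'.symm)
      · simp
    · rw [weight, dif_neg h]
      refine (Finset.sum_eq_zero fun e _ => if_neg fun he => h ?_).symm
      rw [← SimpleGraph.mem_edgeSet, he]
      exact e.2
  rw [finsum_incident_eq, Finset.sum_congr rfl fun e _ => h1 e, Finset.sum_comm]
  exact Finset.sum_congr rfl fun b _ => (h2 b).symm

lemma two_mul_twoMatchingSize [Fintype V] (x : G.edgeSet → ℕ) :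
    2 * twoMatchingSize G x = ∑ a, ∑ b, weight x a b := by
  have h1 : ∀ e : G.edgeSet, (∑ a, if a ∈ e.1 then x e else 0) = 2 * x e := by
    rintro ⟨e, he⟩
    induction e with
    | _ a b =>
      have hne : a ≠ b := SimpleGraph.Adj.ne he
      have h2 : (Finset.univ.filter fun v => v ∈ s(a, b)) = {a, b} := by
        ext v
        simp
      rw [← Finset.sum_filter, h2, Finset.sum_pair hne, two_mul]
  simp_rw [← finsum_incident_eq_sum_weight, finsum_incident_eq]
  rw [Finset.sum_comm, Finset.sum_congr rfl fun e _ => h1 e, ← Finset.mul_sum, twoMatchingSize,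
    finsum_eq_sum_of_fintype]

lemma supportGraph_adj {x : G.edgeSet → ℕ} {a b : V} :
    (supportGraph G x).Adj a b ↔ weight x a b ≠ 0 := by
  rw [supportGraph, SimpleGraph.fromEdgeSet_adj]
  refine ⟨fun ⟨⟨h, hx⟩, _⟩ => ?_, fun h => ?_⟩
  · rwa [weight, dif_pos (show G.Adj a b from h)]
  · have hab := adj_of_weight_ne_zero h
    rw [weight, dif_pos hab] at h
    exact ⟨⟨hab, h⟩, hab.ne⟩

/-- A symmetric weight on pairs of nodes with all node sums at most two and without a triangle in
its support. -/
structure IsTriangleFreeWeight {W : Type*} [Fintype W] (H : SimpleGraph W) (f : W → W → ℕ) :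
    Prop where
  symm : ∀ a b, f a b = f b a
  adj : ∀ a b, f a b ≠ 0 → H.Adj a b
  sum_le : ∀ a, ∑ b, f a b ≤ 2
  triangleFree : ∀ a b c, f a b ≠ 0 → f b c ≠ 0 → f c a = 0

lemma isTriangleFreeTwoMatching_iff [Fintype V] {x : G.edgeSet → ℕ} :
    IsTriangleFreeTwoMatching G x ↔ IsTriangleFreeWeight G (weight x) := by
  have htri : (supportGraph G x).CliqueFree 3 ↔
      ∀ a b c, weight x a b ≠ 0 → weight x b c ≠ 0 → weight x c a = 0 := by
    refine ⟨fun h a b c hab hbc => ?_, fun h T hT => ?_⟩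
    · by_contra hca
      exact h {a, b, c} (SimpleGraph.is3Clique_triple_iff.2 ⟨supportGraph_adj.2 hab,
        (supportGraph_adj.2 hca).symm, supportGraph_adj.2 hbc⟩)
    · obtain ⟨a, b, c, hab, hac, hbc, -⟩ := SimpleGraph.is3Clique_iff.1 hT
      exact supportGraph_adj.1 hac.symm (h a b c (supportGraph_adj.1 hab) (supportGraph_adj.1 hbc))
  rw [IsTriangleFreeTwoMatching, htri, IsTwoMatching]
  simp_rw [finsum_incident_eq_sum_weight]
  refine ⟨fun h => ⟨weight_comm x, fun a b => adj_of_weight_ne_zero, h.1.2, h.2⟩,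
    fun h => ⟨⟨?_, h.sum_le⟩, h.triangleFree⟩⟩
  rintro ⟨e, he⟩
  induction e with
  | _ a b =>
    have h1 := (Finset.single_le_sum (f := weight x a) (fun _ _ => Nat.zero_le _)
      (Finset.mem_univ b)).trans (h.sum_le a)
    rwa [weight, dif_pos (show G.Adj a b from he)] at h1

/-! ### The upper bound -/

section

variable {W : Type*} {H : SimpleGraph W}

lemma reachable_induce_ne {r v : W} (hH : H.Connected) (hr : r ≠ v) {g : W} (hg : g ≠ v)
    (hle : H.dist r g ≤ H.dist r v) : (H.induce {w : W | w ≠ v}).Reachable ⟨r, hr⟩ ⟨g, hg⟩ := by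
  induction hn : H.dist r g generalizing g with
  | zero =>
    have : r = g := (hH r g).dist_eq_zero_iff.1 hn
    subst this
    exact .rfl
  | succ n ih =>
    obtain ⟨g', hadj, hg'⟩ : ∃ g', H.Adj g' g ∧ H.dist r g' = n := by
      obtain ⟨p, hp⟩ := hH.exists_walk_length_eq_dist r g
      have hnil : ¬ p.Nil := by
        rw [← SimpleGraph.Walk.length_eq_zero_iff]
        omega
      refine ⟨p.penultimate, p.adj_penultimate hnil, le_antisymm ?_ ?_⟩
      · have := SimpleGraph.dist_le p.dropLast
        rw [SimpleGraph.Walk.length_dropLast] at this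
        omega
      · have h1 := hH.dist_triangle (u := r) (v := p.penultimate) (w := g)
        rw [SimpleGraph.dist_eq_one_iff_adj.2 (p.adj_penultimate hnil)] at h1
        omega
    have hne : g' ≠ v := by
      rintro rfl
      omega
    refine (ih hne (by omega) hg').trans (SimpleGraph.Adj.reachable ?_)
    exact hadj

/-- Fix a root. Every triangle of a triangle cluster has two nodes besides its node closest to the
root, and these pairs are disjoint for different triangles: a node in two of the pairs would not
separate the two triangles, both of which are joined to the root without it. -/
lemma two_mul_card_triangles_lt [Fintype W] (hH : H.Connected) {𝒯 : Finset (Finset W)}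
    (h3 : ∀ T ∈ 𝒯, T.card = 3)
    (hsep : ∀ T ∈ 𝒯, ∀ T' ∈ 𝒯, T ≠ T' → ∀ v ∈ T, v ∈ T' → Separates H v T T') :
    2 * 𝒯.card < Fintype.card W := by
  obtain ⟨r⟩ := hH.nonempty
  have hgate : ∀ T : Finset W, ∃ g, T ∈ 𝒯 → g ∈ T ∧ ∀ v ∈ T, H.dist r g ≤ H.dist r v := by
    intro T
    by_cases hT : T ∈ 𝒯
    · obtain ⟨g, hg⟩ := Finset.exists_min_image T (H.dist r) (Finset.card_pos.1 (by simp [h3 T hT]))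
      exact ⟨g, fun _ => hg⟩
    · exact ⟨r, fun h => (hT h).elim⟩
  choose g hg using hgate
  have hr : ∀ T ∈ 𝒯, ∀ v ∈ T.erase (g T), r ≠ v := by
    rintro T hT v hv rfl
    rw [Finset.mem_erase] at hv
    have h1 := (hg T hT).2 r hv.2
    rw [SimpleGraph.dist_self, Nat.le_zero] at h1
    exact hv.1 ((hH r (g T)).dist_eq_zero_iff.1 h1)
  have hreach : ∀ T (hT : T ∈ 𝒯) v (hv : v ∈ T.erase (g T)),
      (H.induce {w : W | w ≠ v}).Reachable ⟨r, hr T hT v hv⟩ ⟨g T, (Finset.mem_erase.1 hv).1.symm⟩ :=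
    fun T hT v hv => reachable_induce_ne hH _ _ ((hg T hT).2 v (Finset.mem_of_mem_erase hv))
  have hdisj : (𝒯 : Set (Finset W)).PairwiseDisjoint fun T => T.erase (g T) := by
    intro T hT T' hT' hne
    refine Finset.disjoint_left.2 fun v hv hv' => ?_
    exact hsep T hT T' hT' hne v (Finset.mem_of_mem_erase hv) (Finset.mem_of_mem_erase hv') _ _
      (Finset.mem_erase.1 hv).1.symm (Finset.mem_erase.1 hv').1.symm (hg T hT).1 (hg T' hT').1
      ((hreach T hT v hv).symm.trans (hreach T' hT' v hv'))
  have hcard : (𝒯.biUnion fun T => T.erase (g T)).card = 2 * 𝒯.card := by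
    rw [Finset.card_biUnion hdisj, Finset.sum_congr rfl fun T hT =>
      show (T.erase (g T)).card = 2 by rw [Finset.card_erase_of_mem (hg T hT).1, h3 T hT],
      Finset.sum_const, smul_eq_mul, mul_comm]
  rw [← hcard, ← Finset.card_univ]
  refine Finset.card_lt_card (Finset.ssubset_univ_iff.2 fun h => ?_)
  obtain ⟨T, hT, hrT⟩ := Finset.mem_biUnion.1 (h ▸ Finset.mem_univ r)
  exact hr T hT r hrT rfl

/-- A triangle contributes at most two to the size of a triangle-free 2-matching. -/
lemma IsTriangleFreeWeight.sum_triangle_le [Fintype W] {f : W → W → ℕ}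
    (hf : IsTriangleFreeWeight H f) {T : Finset W} (hT : H.IsNClique 3 T) :
    ∑ a ∈ T, ∑ b ∈ T, f a b ≤ 4 := by
  obtain ⟨a, b, c, hab, hac, hbc, rfl⟩ := SimpleGraph.is3Clique_iff.1 hT
  have hd : ∀ a, f a a = 0 := fun a => by
    by_contra h
    exact (hf.adj a a h).ne rfl
  have hrow : ∀ x, f x a + (f x b + f x c) ≤ 2 := fun x => by
    have h1 := Finset.sum_le_sum_of_subset (f := f x) (Finset.subset_univ {a, b, c})
    rw [Finset.sum_insert (by simp [hab.ne, hac.ne]), Finset.sum_pair hbc.ne] at h1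
    exact h1.trans (hf.sum_le x)
  have hsum : ∀ k : W → ℕ, ∑ x ∈ {a, b, c}, k x = k a + (k b + k c) := fun k => by
    rw [Finset.sum_insert (by simp [hab.ne, hac.ne]), Finset.sum_pair hbc.ne]
  simp only [hsum]
  have h1 := hrow a
  have h2 := hrow b
  have h3 := hrow c
  have h4 := hd a
  have h5 := hd b
  have h6 := hd c
  have h7 := hf.symm a b
  have h8 := hf.symm b c
  have h9 := hf.symm c a
  have h10 := hf.triangleFree a b c
  by_cases k1 : f a b = 0
  · omega
  by_cases k2 : f b c = 0
  · omega
  have := h10 k1 k2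
  omega

lemma IsTriangleFreeWeight.sum_add_two_le [Fintype W] {f : W → W → ℕ}
    (hf : IsTriangleFreeWeight H f) (hH : IsTriangleCluster H) :
    ∑ a, ∑ b, f a b + 2 ≤ 2 * Fintype.card W := by
  obtain ⟨hconn, 𝒯, h1, h2, h3⟩ := hH
  have hlt := two_mul_card_triangles_lt hconn (𝒯 := 𝒯.toFinset)
    (fun T hT => (h1 T (Set.mem_toFinset.1 hT)).card_eq)
    (fun T hT T' hT' hne v hv hv' =>
      (h3 T (Set.mem_toFinset.1 hT) T' (Set.mem_toFinset.1 hT') hne).2 v ⟨hv, hv'⟩)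
  have hle : ∑ a, ∑ b, f a b ≤ ∑ T ∈ 𝒯.toFinset, ∑ a ∈ T, ∑ b ∈ T, f a b := by
    have h4 : ∀ T : Finset W, ∑ a ∈ T, ∑ b ∈ T, f a b =
        ∑ a, ∑ b, if a ∈ T ∧ b ∈ T then f a b else 0 := by
      intro T
      rw [← Finset.sum_subset (Finset.subset_univ T)]
      · refine Finset.sum_congr rfl fun a ha => ?_
        simp [ha]
      · intro a _ ha
        simp [ha]
    simp_rw [h4]
    rw [Finset.sum_comm (s := 𝒯.toFinset)]
    refine Finset.sum_le_sum fun a _ => ?_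
    rw [Finset.sum_comm (s := 𝒯.toFinset)]
    refine Finset.sum_le_sum fun b _ => ?_
    by_cases hab : f a b = 0
    · simp [hab]
    obtain ⟨T, ⟨hT, haT, hbT⟩, -⟩ := h2 a b (hf.adj a b hab)
    have h5 := Finset.single_le_sum (f := fun T : Finset W => if a ∈ T ∧ b ∈ T then f a b else 0)
      (fun _ _ => Nat.zero_le _) (Set.mem_toFinset.2 hT)
    simpa [haT, hbT] using h5
  have hle' : ∑ T ∈ 𝒯.toFinset, ∑ a ∈ T, ∑ b ∈ T, f a b ≤ 𝒯.toFinset.card * 4 :=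
    Finset.sum_le_card_nsmul _ _ _ fun T hT => hf.sum_triangle_le (h1 T (Set.mem_toFinset.1 hT))
  omega

/-- The restriction of a weight along an injective map of nodes. -/
lemma IsTriangleFreeWeight.comp [Fintype W] {W' : Type*} [Fintype W'] {H' : SimpleGraph W'}
    {f : W → W → ℕ} (hf : IsTriangleFreeWeight H f) (i : W' ↪ W)
    (hi : ∀ a b, H.Adj (i a) (i b) → H'.Adj a b) :
    IsTriangleFreeWeight H' (fun a b => f (i a) (i b)) where
  symm a b := hf.symm _ _
  adj a b h := hi a b (hf.adj _ _ h)
  sum_le a := by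
    refine le_trans ?_ (hf.sum_le (i a))
    rw [← Finset.sum_map Finset.univ i (f (i a))]
    exact Finset.sum_le_sum_of_subset (Finset.subset_univ _)
  triangleFree a b c := hf.triangleFree _ _ _

lemma IsTriangleFreeWeight.sum_add_two_mul_clusterCount_le [Fintype W] {f : W → W → ℕ}
    (hf : IsTriangleFreeWeight H f) :
    ∑ a, ∑ b, f a b + 2 * clusterCount H ≤ 2 * Fintype.card W := by
  have h1 : clusterCount H =
      ∑ c : H.ConnectedComponent, if IsTriangleCluster c.toSimpleGraph then 1 else 0 := by
    rw [clusterCount, Set.ncard_eq_toFinset_card', ← Finset.card_filter]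
    congr 1
    ext c
    simp
  have h2 : 2 * Fintype.card W = ∑ c : H.ConnectedComponent,
      ∑ a ∈ Finset.univ.filter (fun a => H.connectedComponentMk a = c), 2 := by
    rw [Finset.sum_fiberwise Finset.univ H.connectedComponentMk fun _ => 2, Finset.sum_const, Finset.card_univ, smul_eq_mul, mul_comm]
  rw [h1, h2, ← Finset.sum_fiberwise Finset.univ H.connectedComponentMk, Finset.mul_sum,
    ← Finset.sum_add_distrib]
  refine Finset.sum_le_sum fun c _ => ?_
  split_ifs with hc
  · have h3 : ∀ k : W → ℕ, ∑ a ∈ Finset.univ.filter (fun a => H.connectedComponentMk a = c), k a =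
        ∑ a : c, k a := fun k => Finset.sum_subtype _ (fun a => by simp; rfl) k
    have h4 : ∀ a : c, ∑ b, f a b = ∑ b : c, f a b := by
      intro a
      rw [← h3, Finset.sum_filter]
      refine Finset.sum_congr rfl fun b _ => ?_
      split_ifs with hb
      · rfl
      · by_contra h
        refine hb ?_
        rw [← show H.connectedComponentMk a.1 = c from a.2]
        exact SimpleGraph.ConnectedComponent.eq.2 (hf.adj _ _ h).reachable.symm
    have h5 := (hf.comp (H' := c.toSimpleGraph) (Function.Embedding.subtype _)
      (fun a b h => h)).sum_add_two_le hc
    rw [h3, h3, Finset.sum_congr rfl fun a _ => h4 a, Finset.sum_const, Finset.card_univ,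
      smul_eq_mul, mul_comm _ 2]
    exact h5
  · rw [mul_zero, add_zero]
    exact Finset.sum_le_sum fun a _ => hf.sum_le a

end

/-- The edges at `U` contribute at most `2 * #U`, and the edges in a component of `G - U` contribute
at most the number of its nodes, less one if it is a triangle cluster. -/
theorem twoMatchingSize_add_clusterCount_le [Fintype V] {x : G.edgeSet → ℕ}
    (hx : IsTriangleFreeTwoMatching G x) (U : Finset V) :
    twoMatchingSize G x + clusterCount (removeNodes G U) ≤ Fintype.card V + U.card := by
  have hf := isTriangleFreeTwoMatching_iff.1 hx
  have h1 := (hf.comp (H' := removeNodes G U) (Function.Embedding.subtype _)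
    (fun a b h => h)).sum_add_two_mul_clusterCount_le
  have h2 := two_mul_twoMatchingSize x
  have hsub : ∀ k : V → ℕ, ∑ a ∈ Uᶜ, k a = ∑ a : {v : V | v ∉ U}, k a := fun k =>
    Finset.sum_subtype _ (fun a => by simp) k
  have hU : ∑ a ∈ U, ∑ b, weight x a b ≤ U.card * 2 :=
    Finset.sum_le_card_nsmul _ _ _ fun a _ => hf.sum_le a
  have hU' : ∑ a ∈ Uᶜ, ∑ b ∈ U, weight x a b ≤ U.card * 2 := by
    rw [Finset.sum_comm]
    refine Finset.sum_le_card_nsmul _ _ _ fun b _ => le_trans ?_ (hf.sum_le b)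
    simp_rw [weight_comm x _ b]
    exact Finset.sum_le_sum_of_subset (Finset.subset_univ _)
  have h3 : ∑ a, ∑ b, weight x a b = ∑ a ∈ U, ∑ b, weight x a b +
      (∑ a ∈ Uᶜ, ∑ b ∈ U, weight x a b + ∑ a ∈ Uᶜ, ∑ b ∈ Uᶜ, weight x a b) := by
    rw [← Finset.sum_add_distrib, ← Finset.sum_add_sum_compl U]
    simp_rw [Finset.sum_add_sum_compl]
  have h4 : Fintype.card {v : V | v ∉ U} + U.card = Fintype.card V := by
    have := hsub fun _ => 1
    simp only [Finset.sum_const, smul_eq_mul, mul_one, Finset.card_univ] at this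
    rw [← this, add_comm, Finset.card_add_card_compl]
  simp_rw [hsub] at h3
  simp only [Function.Embedding.subtype_apply] at h1
  simp_rw [hsub] at hU'
  omega

end

section

variable {V : Type*} [Fintype V] {G : SimpleGraph V}

/-! ### The lower bound -/

lemma Packable.biUnion {ι : Type*} {s : Finset ι} {P : ι → Finset V}
    (hP : ∀ i ∈ s, Packable G (P i)) (hd : (s : Set ι).PairwiseDisjoint P) :
    Packable G (s.biUnion P) := by
  induction s using Finset.induction_on with
  | empty => simpa using Packable.empty
  | insert i s hi ih =>
    rw [Finset.biUnion_insert]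
    refine (hP i (by simp)).union (ih (fun j hj => hP j (by simp [hj]))
      (hd.subset (by simp))) ?_
    rw [Finset.disjoint_biUnion_right]
    exact fun j hj => hd (by simp) (by simp [hj]) (by rintro rfl; exact hi hj)

lemma Packable.exists_twoMatching {S : Finset V} (h : Packable G S) :
    ∃ x, IsTriangleFreeTwoMatching G x ∧ IsBasic G x ∧ twoMatchingSize G x = S.card := by
  obtain ⟨f, hf⟩ := h
  let x : G.edgeSet → ℕ := fun e => Sym2.lift ⟨f, hf.symm⟩ e.1
  have hx : weight x = f := by
    ext a b
    by_cases hab : G.Adj a b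
    · simp [weight, hab, x]
    · rw [weight, dif_neg hab]
      by_contra h
      exact hab (hf.adj a b (Ne.symm h))
  have hout : ∀ a ∉ S, ∑ b, f a b = 0 := fun a ha => Finset.sum_eq_zero fun b _ => by
    by_contra h
    exact ha (hf.mem a b h)
  refine ⟨x, isTriangleFreeTwoMatching_iff.2 (hx ▸ ⟨hf.symm, hf.adj, fun a => ?_, hf.triangleFree⟩),
    ?_, ?_⟩
  · by_cases ha : a ∈ S
    · exact (hf.sum a ha).le
    · simp [hout a ha]
  · obtain ⟨𝒞, h1, h2, -, h4⟩ := hf.basic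
    refine ⟨𝒞, h1, h2, ?_⟩
    ext e
    induction e with
    | _ a b =>
      simp only [Set.mem_iUnion, SimpleGraph.Subgraph.mem_edgeSet, exists_prop, ← h4]
      refine ⟨fun ⟨h, hab⟩ => hab, fun hab => ⟨hf.adj a b (by simp [hab]), hab⟩⟩
  · have h1 := two_mul_twoMatchingSize x
    rw [hx, ← Finset.sum_add_sum_compl S, Finset.sum_congr rfl hf.sum,
      Finset.sum_eq_zero (s := Sᶜ) fun a ha => hout a (Finset.mem_compl.1 ha),
      Finset.sum_const, smul_eq_mul] at h1
    omega

/-- Hall's theorem assigns the members of `𝒦` to distinct places: neighbours in `U`, `d` places open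
to all members, and `e` places open to the packable members only. -/
lemma IsGallaiEdmonds.exists_assignment {U : Finset V} {𝒦 : Finset (Finset V)}
    (h : IsGallaiEdmonds G Finset.univ U 𝒦) {d e : ℕ} (he : 𝒦.card = U.card + d + e)
    (hd : ∀ 𝒮 ⊆ 𝒦.filter fun K => ¬ Packable G K, 𝒮.card ≤ (nbrs G U 𝒮).card + d) :
    ∃ g : 𝒦 → V ⊕ (Fin d ⊕ Fin e), Function.Injective g ∧
      (∀ K u, g K = Sum.inl u → u ∈ nbrs G U {K.1}) ∧
      ∀ K i, g K = Sum.inr (Sum.inr i) → Packable G K.1 := by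
  let t : 𝒦 → Finset (V ⊕ (Fin d ⊕ Fin e)) := fun K => (nbrs G U {K.1}).disjSum
    (Finset.univ.disjSum (if Packable G K.1 then Finset.univ else ∅))
  have hHall : ∀ s : Finset 𝒦, s.card ≤ (s.biUnion t).card := by
    intro s
    obtain rfl | ⟨K₀, hK₀⟩ := s.eq_empty_or_nonempty
    · simp
    let 𝒮 : Finset (Finset V) := s.map (Function.Embedding.subtype _)
    have hcard : 𝒮.card = s.card := Finset.card_map _
    have h𝒮 : 𝒮 ⊆ 𝒦 := fun K hK => by
      obtain ⟨K', -, rfl⟩ := Finset.mem_map.1 hK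
      exact K'.2
    have hnbrs : ∀ u ∈ nbrs G U 𝒮, ∃ K ∈ s, u ∈ nbrs G U {K.1} := by
      intro u hu
      obtain ⟨hU, K, hK, a, ha, hua⟩ := Finset.mem_filter.1 hu
      obtain ⟨K', hK', rfl⟩ := Finset.mem_map.1 hK
      exact ⟨K', hK', Finset.mem_filter.2 ⟨hU, K'.1, by simp, a, ha, hua⟩⟩
    by_cases hgood : ∃ K ∈ s, Packable G K.1
    · obtain ⟨K₁, hK₁, hP⟩ := hgood
      have hsub : (nbrs G U 𝒮).disjSum (Finset.univ : Finset (Fin d ⊕ Fin e)) ⊆ s.biUnion t := by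
        rintro (u | i | i) hu
        · obtain ⟨K, hK, hu'⟩ := hnbrs u (by simpa using hu)
          exact Finset.mem_biUnion.2 ⟨K, hK, by simpa [t] using hu'⟩
        · exact Finset.mem_biUnion.2 ⟨K₁, hK₁, by simp [t]⟩
        · exact Finset.mem_biUnion.2 ⟨K₁, hK₁, by simp [t, hP]⟩
      have h1 := Finset.card_le_card hsub
      have h2 := h.card_add_card_le h𝒮
      rw [Finset.card_disjSum, Finset.card_univ, Fintype.card_sum, Fintype.card_fin,
        Fintype.card_fin] at h1
      omega
    · push Not at hgood
      have hsub : (nbrs G U 𝒮).disjSum ((Finset.univ : Finset (Fin d)).disjSum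
          (∅ : Finset (Fin e))) ⊆ s.biUnion t := by
        rintro (u | i | i) hu
        · obtain ⟨K, hK, hu'⟩ := hnbrs u (by simpa using hu)
          exact Finset.mem_biUnion.2 ⟨K, hK, by simpa [t] using hu'⟩
        · exact Finset.mem_biUnion.2 ⟨K₀, hK₀, by simp [t]⟩
        · simp at hu
      have h1 := Finset.card_le_card hsub
      have h2 := hd 𝒮 fun K hK => by
        obtain ⟨K', hK', rfl⟩ := Finset.mem_map.1 hK
        exact Finset.mem_filter.2 ⟨K'.2, hgood K' hK'⟩
      rw [Finset.card_disjSum, Finset.card_disjSum, Finset.card_univ, Fintype.card_fin,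
        Finset.card_empty] at h1
      omega
  obtain ⟨g, hg, hgt⟩ := (Finset.all_card_le_biUnion_card_iff_exists_injective t).1 hHall
  refine ⟨g, hg, fun K u hu => ?_, fun K i hi => ?_⟩
  · have := hgt K
    rw [hu] at this
    simpa [t] using this
  · have := hgt K
    rw [hi] at this
    by_contra hc
    simp [t, hc] at this

/-- Each member of `𝒦` is covered together with the node of `U` assigned to it, or by itself, or up
to one node; at most `d` members lose a node. -/
lemma IsGallaiEdmonds.exists_packable {U : Finset V} {𝒦 : Finset (Finset V)}
    (h : IsGallaiEdmonds G Finset.univ U 𝒦) {d e : ℕ} (he : 𝒦.card = U.card + d + e)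
    (hd : ∀ 𝒮 ⊆ 𝒦.filter fun K => ¬ Packable G K, 𝒮.card ≤ (nbrs G U 𝒮).card + d) :
    ∃ S, Packable G S ∧ Fintype.card V ≤ S.card + d := by
  obtain ⟨g, hg, hgU, hgP⟩ := h.exists_assignment he hd
  have hKU : ∀ K : 𝒦, ∀ v ∈ K.1, v ∉ U := fun K v hv => by simpa using h.part K.1 K.2 hv
  have hP : ∀ K : 𝒦, ∃ P : Finset V, Packable G P ∧
      (∀ v ∈ P, v ∈ K.1 ∨ v ∈ U ∧ g K = Sum.inl v) ∧
      P.card + (if ∃ i, g K = Sum.inr (Sum.inl i) then 1 else 0) =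
        K.1.card + if ∃ u, g K = Sum.inl u then 1 else 0 := by
    intro K
    have hcrit := h.critical K.1 K.2
    rcases hgK : g K with u | i | i
    · obtain ⟨hu, K', hK', a, ha, hua⟩ := Finset.mem_filter.1 (hgU K u hgK)
      rw [Finset.mem_singleton] at hK'
      subst hK'
      have huK : u ∉ K.1 := fun hc => hKU K u hc hu
      have h1 : K.1.erase a ∪ {u, a} = insert u K.1 := by
        ext v
        simp only [Finset.mem_union, Finset.mem_erase, Finset.mem_insert, Finset.mem_singleton]
        grind
      refine ⟨insert u K.1, ?_, fun v hv => ?_, ?_⟩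
      · rw [← h1]
        exact ((hcrit.2 a ha).union (.pair hua) (by simp [huK])).packable
      · rcases Finset.mem_insert.1 hv with rfl | hv
        · exact Or.inr ⟨hu, rfl⟩
        · exact Or.inl hv
      · simp [Finset.card_insert_of_notMem huK]
    · obtain ⟨a, ha⟩ := hcrit.1
      refine ⟨K.1.erase a, (hcrit.2 a ha).packable, fun v hv => Or.inl (Finset.mem_of_mem_erase hv), ?_⟩
      simp [Finset.card_erase_add_one ha]
    · exact ⟨K.1, hgP K i hgK, fun v hv => Or.inl hv, by simp⟩
  choose P hPP hPmem hPcard using hP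
  have hdisj : ((Finset.univ : Finset 𝒦) : Set 𝒦).PairwiseDisjoint P := by
    intro K _ K' _ hne
    refine Finset.disjoint_left.2 fun v hv hv' => hne ?_
    rcases hPmem K v hv with h1 | h1 <;> rcases hPmem K' v hv' with h2 | h2
    · exact Subtype.ext (h.eq_of_mem K.1 K.2 K'.1 K'.2 v h1 h2)
    · exact (hKU K v h1 h2.1).elim
    · exact (hKU K' v h2 h1.1).elim
    · exact hg (h1.2.trans h2.2.symm)
  refine ⟨Finset.univ.biUnion P, .biUnion (fun K _ => hPP K) hdisj, ?_⟩
  rw [Finset.card_biUnion fun K hK K' hK' hne => hdisj hK hK' hne]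
  have h1 : ∑ K, (P K).card + (Finset.univ.filter fun K => ∃ i, g K = Sum.inr (Sum.inl i)).card =
      ∑ K : 𝒦, K.1.card + (Finset.univ.filter fun K => ∃ u, g K = Sum.inl u).card := by
    rw [Finset.card_filter, Finset.card_filter, ← Finset.sum_add_distrib, ← Finset.sum_add_distrib]
    exact Finset.sum_congr rfl fun K _ => hPcard K
  have h2 : (Finset.univ.filter fun K => ∃ i, g K = Sum.inr (Sum.inl i)).card ≤ d := by
    have := Finset.card_le_card_of_injOn
      (s := Finset.univ.filter fun K => ∃ i, g K = Sum.inr (Sum.inl i))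
      (t := (Finset.univ : Finset (Fin d)).image fun i => Sum.inr (Sum.inl i)) g
      (fun K hK => by
        obtain ⟨i, hi⟩ := (Finset.mem_filter.1 hK).2
        exact Finset.mem_image.2 ⟨i, Finset.mem_univ _, hi.symm⟩) hg.injOn
    simpa using this.trans Finset.card_image_le
  have h3 : (Finset.univ.filter fun K => ∃ i, g K = Sum.inr (Sum.inr i)).card ≤ e := by
    have := Finset.card_le_card_of_injOn
      (s := Finset.univ.filter fun K => ∃ i, g K = Sum.inr (Sum.inr i))
      (t := (Finset.univ : Finset (Fin e)).image fun i => Sum.inr (Sum.inr i)) g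
      (fun K hK => by
        obtain ⟨i, hi⟩ := (Finset.mem_filter.1 hK).2
        exact Finset.mem_image.2 ⟨i, Finset.mem_univ _, hi.symm⟩) hg.injOn
    simpa using this.trans Finset.card_image_le
  have h4 : 𝒦.card ≤ (Finset.univ.filter fun K => ∃ u, g K = Sum.inl u).card +
      (Finset.univ.filter fun K => ∃ i, g K = Sum.inr (Sum.inl i)).card +
      (Finset.univ.filter fun K => ∃ i, g K = Sum.inr (Sum.inr i)).card := by
    rw [Finset.card_filter, Finset.card_filter, Finset.card_filter, ← Finset.sum_add_distrib,
      ← Finset.sum_add_distrib, ← Fintype.card_coe, ← Finset.card_univ, Finset.card_eq_sum_ones]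
    refine Finset.sum_le_sum fun K _ => ?_
    rcases g K with u | i | i <;> simp
  have h5 : Fintype.card V ≤ U.card + ∑ K : 𝒦, K.1.card := by
    have hsub : (Finset.univ : Finset V) ⊆ U ∪ 𝒦.biUnion id := fun v _ => by
      simpa using h.cover v (Finset.mem_univ v)
    have h6 := (Finset.card_le_card hsub).trans (Finset.card_union_le _ _)
    have h7 : (𝒦.biUnion id).card ≤ ∑ K ∈ 𝒦, K.card := Finset.card_biUnion_le
    rw [← Finset.sum_coe_sort 𝒦 Finset.card] at h7
    rw [Finset.card_univ] at h6
    omega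
  omega

/-- For a Gallai–Edmonds decomposition `U`, `𝒦`, let `𝒮` be a set of members of `𝒦` that are not
packable with the largest deficiency `#𝒮 - #N(𝒮)`. The neighbourhood `N(𝒮)` attains the minimum in
the min-max formula, since the members of `𝒮` are triangle clusters and components of
`G - N(𝒮)`. -/
theorem exists_packable_add_clusterCount (G : SimpleGraph V) : ∃ S U : Finset V, Packable G S ∧
    Fintype.card V + U.card ≤ S.card + clusterCount (removeNodes G U) := by
  obtain ⟨U, 𝒦, h⟩ := exists_isGallaiEdmonds G Finset.univ
  obtain ⟨𝒮, h𝒮, hmax⟩ := Finset.exists_max_image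
    (𝒦.filter fun K => ¬ Packable G K).powerset
    (fun 𝒮 => (𝒮.card : ℤ) - (nbrs G U 𝒮).card) ⟨∅, by simp⟩
  rw [Finset.mem_powerset] at h𝒮
  have h𝒮𝒦 : 𝒮 ⊆ 𝒦 := h𝒮.trans (Finset.filter_subset _ _)
  obtain ⟨d, hd⟩ : ∃ d, 𝒮.card = (nbrs G U 𝒮).card + d := by
    have h1 := hmax ∅ (by simp)
    have h2 : nbrs G U ∅ = ∅ := by simp [nbrs]
    rw [h2] at h1
    exact Nat.exists_eq_add_of_le (by simpa using h1)
  obtain ⟨e, he⟩ : ∃ e, 𝒦.card = U.card + d + e := by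
    have h1 := h.card_add_card_le h𝒮𝒦
    exact Nat.exists_eq_add_of_le (by omega)
  obtain ⟨S, hS, hcard⟩ := h.exists_packable he fun 𝒮' h𝒮' => by
    have := hmax 𝒮' (Finset.mem_powerset.2 h𝒮')
    omega
  have hcl := card_le_clusterCount (G := G) (U := nbrs G U 𝒮) (𝒮 := 𝒮)
    (fun K hK => (h.critical K (h𝒮𝒦 hK)).triangleTree (Finset.mem_filter.1 (h𝒮 hK)).2)
    (fun K hK a ha haU => (Finset.mem_sdiff.1 (h.part K (h𝒮𝒦 hK) ha)).2 (Finset.mem_filter.1 haU).1)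
    (fun K hK K' hK' => h.eq_of_mem K (h𝒮𝒦 hK) K' (h𝒮𝒦 hK'))
    (fun K hK a ha b hb hab => (h.closed K (h𝒮𝒦 hK) a ha b (Finset.mem_univ b) hab).resolve_right
      fun hbU => hb (Finset.mem_filter.2 ⟨hbU, K, hK, a, ha, hab.symm⟩))
  exact ⟨S, nbrs G U 𝒮, hS, by omega⟩

end

end TwoMatching

theorem mainTheorem1 {V : Type*} [Fintype V] (G : SimpleGraph V) :
    IsGreatest {k : ℕ | ∃ x, IsTriangleFreeTwoMatching G x ∧ twoMatchingSize G x = k}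
      (triangleFreeTwoMatchingNumber G) ∧
    IsGreatest {k : ℕ | ∃ x, IsTriangleFreeTwoMatching G x ∧ IsBasic G x ∧
      twoMatchingSize G x = k} (triangleFreeTwoMatchingNumber G) ∧
    IsLeast (Set.range fun U : Finset V =>
        (Fintype.card V : ℤ) + (U.card : ℤ) - (clusterCount (removeNodes G U) : ℤ))
      (triangleFreeTwoMatchingNumber G : ℤ) := by
  obtain ⟨S, U, hS, hU⟩ := TwoMatching.exists_packable_add_clusterCount G
  obtain ⟨x, hx, hbasic, hsize⟩ := hS.exists_twoMatching
  have hle : ∀ y, IsTriangleFreeTwoMatching G y → ∀ U' : Finset V,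
      twoMatchingSize G y + clusterCount (removeNodes G U') ≤ Fintype.card V + U'.card :=
    fun y hy U' => TwoMatching.twoMatchingSize_add_clusterCount_le hy U'
  have hxU := hle x hx U
  have hgreatest : IsGreatest
      {k : ℕ | ∃ x, IsTriangleFreeTwoMatching G x ∧ twoMatchingSize G x = k}
      (twoMatchingSize G x) := by
    refine ⟨⟨x, hx, rfl⟩, ?_⟩
    rintro k ⟨y, hy, rfl⟩
    have := hle y hy U
    omega
  have hnum : triangleFreeTwoMatchingNumber G = twoMatchingSize G x := hgreatest.csSup_eq
  rw [hnum]
  refine ⟨hgreatest, ⟨⟨x, hx, hbasic, rfl⟩, ?_⟩, ⟨U, ?_⟩, ?_⟩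
  · rintro k ⟨y, hy, -, rfl⟩
    exact hgreatest.2 ⟨y, hy, rfl⟩
  · dsimp only
    omega
  · rintro _ ⟨U', rfl⟩
    have := hle x hx U'
    dsimp only
    omega
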